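/- Let $n\ge 1$ and let $p(\cdot):\mathbb R^n\to[1,\infty]$ be a measurable function with $p_-:=\operatorname{ess\,inf}p\ge 1$ and $p_+:=\operatorname{ess\,sup}p<\infty$. For a measurable function $f$ on $\mathbb R^n$ put $$\|f\|_{L^{p(\cdot)}}:=\inf\Big\{\lambda>0:\int_{\mathbb R^n}\Big(\frac{|f(x)|}{\lambda}\Big)^{p(x)}dx\le 1\Big\}\qquad(\inf\emptyset=\infty),$$ and let $L^{p(\cdot)}$ be the space of real-valued measurable functions $f$ with $\|f\|_{L^{p(\cdot)}}<\infty$. Cubes are nondegenerate cubes $Q\subset\mathbb R^n$ with sides parallel to the axes, taken half-open, $Q=\prod_{i=1}^n[a_i,a_i+h)$ with $h>0$; $|E|$ is the Lebesgue measure of $E$ and $\chi_E$ its indicator function. We say that $p(\cdot)\in\mathcal A_\infty$ if there exist $\lambda\in(0,1)$ and $C>0$ such that for every family $\mathcal F$ of pairwise disjoint cubes, all numbers $t_Q\ge 0$ $(Q\in\mathcal F)$, and all measurable sets $E_Q\subset Q$ $(Q\in\mathcal F)$ with $|E_Q|\ge\lambda|Q|$, $$\Big\|\sum_{Q\in\mathcal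 F}t_Q\chi_Q\Big\|_{L^{p(\cdot)}}\le C\,\Big\|\sum_{Q\in\mathcal F}t_Q\chi_{E_Q}\Big\|_{L^{p(\cdot)}}.$$ For $t\in(0,1)$ the median maximal operator $m_t$ is defined by $$m_tf(x):=\sup_{Q\ni x}(f\chi_Q)^*(t|Q|),$$ where the supremum is over all cubes $Q$ containing $x$ and $g^*(s):=\inf\{\alpha>0:|\{x:|g(x)|>\alpha\}|\le s\}$ is the non-increasing rearrangement of $g$. It is bounded on $L^{p(\cdot)}$ if there is a constant $C<\infty$ with $\|m_tf\|_{L^{p(\cdot)}}\le C\|f\|_{L^{p(\cdot)}}$ for all $f\in L^{p(\cdot)}$. **Theorem.** $p(\cdot)\in\mathcal A_\infty$ if and only if there exists $t\in(0,1)$ such that $m_t$ is bounded on $L^{p(\cdot)}$. -/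

import Mathlib

open MeasureTheory Set
open scoped ENNReal NNReal

namespace VarExp

/-- A (nondegenerate) cube in `ℝⁿ` with sides parallel to the axes, given by its lower corner and
its side length. -/
structure AxisCube (n : ℕ) where
  corner : Fin n → ℝ
  side : ℝ
  side_pos : 0 < side

/-- The points of the cube: the product of the intervals `[corner i, corner i + side)`.
With the half-open convention, two cubes are disjoint exactly when their interiors are. -/
def AxisCube.toSet {n : ℕ} (Q : AxisCube n) : Set (Fin n → ℝ) :=
  Set.univ.pi fun i => Set.Ico (Q.corner i) (Q.corner i + Q.side)

/-- The power `s ^ q` for `s, q ∈ [0, ∞]`, with the usual convention for variable exponents that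
`s ^ ∞` is `0` for `s ≤ 1` and `∞` for `s > 1`. -/
noncomputable def expPow (s q : ℝ≥0∞) : ℝ≥0∞ :=
  open Classical in
  if q = ∞ then (if s ≤ 1 then 0 else ∞) else s ^ q.toReal

/-- The modular `∫ g(x) ^ p(x) dx` of a function `g` with values in `[0, ∞]`. -/
noncomputable def modular {n : ℕ} (p g : (Fin n → ℝ) → ℝ≥0∞) : ℝ≥0∞ :=
  ∫⁻ x, expPow (g x) (p x)

/-- The Luxemburg norm of the variable Lebesgue space, for a function `g` with values in `[0, ∞]`:
the infimum of all real `l > 0` with `∫ (g(x) / l) ^ p(x) dx ≤ 1`; it is `∞` if there are none. -/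
noncomputable def luxNorm {n : ℕ} (p g : (Fin n → ℝ) → ℝ≥0∞) : ℝ≥0∞ :=
  ⨅ (l : ℝ≥0) (_ : 0 < l) (_ : modular p (fun x => g x / l) ≤ 1), (l : ℝ≥0∞)

/-- Membership of a real-valued function in the variable Lebesgue space. -/
def MemVarLp {n : ℕ} (p : (Fin n → ℝ) → ℝ≥0∞) (f : (Fin n → ℝ) → ℝ) : Prop :=
  AEMeasurable f ∧ luxNorm p (fun x => ‖f x‖ₑ) < ∞

/-- The non-increasing rearrangement
`f^*(s) = inf {a > 0 : |{x : |f(x)| > a}| ≤ s}`. -/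
noncomputable def rearrangement {n : ℕ} (f : (Fin n → ℝ) → ℝ) (s : ℝ≥0∞) : ℝ≥0∞ :=
  ⨅ (a : ℝ≥0) (_ : 0 < a) (_ : volume {x | (a : ℝ) < |f x|} ≤ s), (a : ℝ≥0∞)

/-- The median maximal operator
`m_t f(x) = sup_{Q ∋ x} (f χ_Q)^*(t |Q|)`, with values in `[0, ∞]`. -/
noncomputable def medianMaximal {n : ℕ} (t : ℝ) (f : (Fin n → ℝ) → ℝ) (x : Fin n → ℝ) : ℝ≥0∞ :=
  ⨆ (Q : AxisCube n) (_ : x ∈ Q.toSet),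
    rearrangement (Q.toSet.indicator f) (ENNReal.ofReal t * volume Q.toSet)

/-- `m_t` is bounded on the variable Lebesgue space with exponent `p`. -/
def MedianMaximalBounded {n : ℕ} (t : ℝ) (p : (Fin n → ℝ) → ℝ≥0∞) : Prop :=
  ∃ C : ℝ≥0, ∀ f : (Fin n → ℝ) → ℝ, MemVarLp p f →
    luxNorm p (medianMaximal t f) ≤ C * luxNorm p (fun x => ‖f x‖ₑ)

/-- The step function `∑_{Q ∈ F} c_Q χ_{A_Q}`. -/
noncomputable def stepSum {n : ℕ} (F : Set (AxisCube n)) (c : AxisCube n → ℝ≥0)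
    (A : AxisCube n → Set (Fin n → ℝ)) (x : Fin n → ℝ) : ℝ≥0∞ :=
  ∑' Q : F, (A Q).indicator (fun _ => (c Q : ℝ≥0∞)) x

/-- The condition `𝒜_∞` on an exponent `p`: there are `lam ∈ (0, 1)` and `C > 0` such that for every
family `F` of pairwise disjoint cubes, all `c_Q ≥ 0` and all measurable `E_Q ⊆ Q` with
`|E_Q| ≥ lam |Q|`, the norm of `∑ c_Q χ_Q` is at most `C` times that of `∑ c_Q χ_{E_Q}`. -/
def AInfty {n : ℕ} (p : (Fin n → ℝ) → ℝ≥0∞) : Prop :=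
  ∃ lam ∈ Set.Ioo (0 : ℝ) 1, ∃ C : ℝ≥0, 0 < C ∧
    ∀ F : Set (AxisCube n), F.PairwiseDisjoint AxisCube.toSet →
    ∀ c : AxisCube n → ℝ≥0, ∀ E : AxisCube n → Set (Fin n → ℝ),
      (∀ Q ∈ F, NullMeasurableSet (E Q) ∧ E Q ⊆ Q.toSet ∧
        ENNReal.ofReal lam * volume Q.toSet ≤ volume (E Q)) →
      luxNorm p (stepSum F c AxisCube.toSet) ≤ C * luxNorm p (stepSum F c E)

end VarExp

namespace VarExp

/-! ### Cubes -/

namespace AxisCube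

variable {n : ℕ}

/-! If `m_t` is bounded, put `f = ∑ t_Q χ_{E_Q}` with `|E_Q| ≥ (1 + t)/2 · |Q|`. Each `E_Q` fills
more than the proportion `t` of `Q`, so `m_t f ≥ t_Q` on `Q`, and boundedness gives `𝒜_∞`.

For the other direction, `t = 1/2` works. Since the exponent lies in `[1, P]`, norm inequalities
become modular ones: `ModDom` says that total modular at most `1` on the sets `E_Q` forces total
modular at most `K` on the cubes. The modular is not homogeneous, so this is weaker than a bound by
a multiple of the total on the `E_Q`. The median maximal function must nevertheless be summed over
all levels `2^k`, so multiplicative bounds with summable errors are needed.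

Self-improvement: domination for one proportion `lam < 1` implies it for every proportion
(`ModDom.exists_forall`). A stopping-time argument replaces `E` by a union of cubes whose measure is
larger by the factor `1 / lam`, and this is iterated.

Single cubes: splitting a cube at a quantile of `q` and rescaling the constant so that the modular
of one part becomes `1` turns domination into a bound of the modular on `Q` by a multiple of that on
any large subset. This works for `s ≥ 1` if the modular on the subset is small
(`ModDom.wt_le_of_one_le`), and for `s ≤ 1` if the modular on `Q` exceeds `K`
(`ModDom.wt_le_of_le_one`).

For `s ≤ 1` the remaining cubes may be bad, but they all lie in a set `V` of modular at most a
constant (`exists_bad_cover`). A constant error per level is not summable. Cubes not contained in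
`V` satisfy an `A_∞` condition for the weight `s ^ q`, hence a reverse Hölder inequality off `V`
(`reverseHolder`). It transfers comparability from level `s` to level `s ^ (1 + ε)`, where the
modular of `V` has gained a factor `s ^ ε`. The errors now form a geometric series. A Vitali
covering at each level (`exists_level_estimate`) and summation over dyadic levels
(`exists_modular_estimate`) finish the proof. -/

theorem measurableSet_toSet (Q : AxisCube n) : MeasurableSet Q.toSet :=
  MeasurableSet.univ_pi fun _ => measurableSet_Ico

theorem volume_toSet (Q : AxisCube n) : volume Q.toSet = ENNReal.ofReal Q.side ^ n := by
  simp [toSet, Real.volume_pi_Ico]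

theorem volume_pos (Q : AxisCube n) : 0 < volume Q.toSet := by
  rw [volume_toSet]
  exact ENNReal.pow_pos (ENNReal.ofReal_pos.2 Q.side_pos) _

theorem volume_ne_zero (Q : AxisCube n) : volume Q.toSet ≠ 0 := Q.volume_pos.ne'

theorem volume_ne_top (Q : AxisCube n) : volume Q.toSet ≠ ∞ := by
  rw [volume_toSet]
  exact ENNReal.pow_ne_top ENNReal.ofReal_ne_top

theorem corner_mem (Q : AxisCube n) : Q.corner ∈ Q.toSet := fun i _ =>
  ⟨le_rfl, by linarith [Q.side_pos]⟩

theorem nonempty_toSet (Q : AxisCube n) : Q.toSet.Nonempty := ⟨_, Q.corner_mem⟩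

theorem mem_toSet {Q : AxisCube n} {x : Fin n → ℝ} :
    x ∈ Q.toSet ↔ ∀ i, Q.corner i ≤ x i ∧ x i < Q.corner i + Q.side := by
  simp [toSet, Set.mem_pi]

theorem nonempty_interior (Q : AxisCube n) : (interior Q.toSet).Nonempty := by
  refine ⟨fun i => Q.corner i + Q.side / 2, ?_⟩
  rw [toSet, interior_pi_set finite_univ]
  intro i _
  simp only [interior_Ico]
  constructor <;> linarith [Q.side_pos]

theorem countable_of_pairwiseDisjoint {U : Set (AxisCube n)} (hU : U.PairwiseDisjoint toSet) :
    U.Countable :=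
  hU.countable_of_nonempty_interior fun Q _ => Q.nonempty_interior

/-- The cube with the same centre and five times the side length. -/
def dilate (Q : AxisCube n) : AxisCube n where
  corner i := Q.corner i - 2 * Q.side
  side := 5 * Q.side
  side_pos := by linarith [Q.side_pos]

theorem volume_dilate (Q : AxisCube n) : volume Q.dilate.toSet = 5 ^ n * volume Q.toSet := by
  rw [volume_toSet, volume_toSet, dilate, ENNReal.ofReal_mul (by norm_num), mul_pow]
  norm_num

theorem subset_dilate (Q : AxisCube n) : Q.toSet ⊆ Q.dilate.toSet := by
  intro x hx
  rw [mem_toSet] at hx ⊢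
  intro i
  have := hx i
  simp only [dilate]
  constructor <;> linarith [Q.side_pos]

theorem subset_dilate_of_inter_nonempty {Q R : AxisCube n} (h : (Q.toSet ∩ R.toSet).Nonempty)
    (hs : Q.side ≤ 2 * R.side) : Q.toSet ⊆ R.dilate.toSet := by
  obtain ⟨z, hzQ, hzR⟩ := h
  intro x hx
  rw [mem_toSet] at hx hzQ hzR ⊢
  intro i
  have h1 := hx i
  have h2 := hzQ i
  have h3 := hzR i
  simp only [dilate]
  constructor <;> linarith

/-- Vitali covering for cubes of bounded size. -/
theorem exists_vitali (T : Set (AxisCube n)) (B : ℝ) (hB : ∀ Q ∈ T, Q.side ≤ B) :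
    ∃ U ⊆ T, U.PairwiseDisjoint toSet ∧ ∀ Q ∈ T, ∃ R ∈ U, Q.toSet ⊆ R.dilate.toSet := by
  obtain ⟨U, hUT, hd, hc⟩ := Vitali.exists_disjoint_subfamily_covering_enlargement
    (toSet (n := n)) T side 2 (by norm_num) (fun Q _ => Q.side_pos.le) B hB
    (fun Q _ => Q.nonempty_toSet)
  refine ⟨U, hUT, hd, fun Q hQ => ?_⟩
  obtain ⟨R, hR, h1, h2⟩ := hc Q hQ
  exact ⟨R, hR, subset_dilate_of_inter_nonempty h1 h2⟩

/-- The cube containing `x` in the `j`-th generation of the dyadic grid generated by `Q`. -/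
noncomputable def dyadic (Q : AxisCube n) (j : ℕ) (x : Fin n → ℝ) : AxisCube n where
  corner i := Q.corner i + Q.side / 2 ^ j * ⌊(x i - Q.corner i) / (Q.side / 2 ^ j)⌋
  side := Q.side / 2 ^ j
  side_pos := div_pos Q.side_pos (by positivity)

theorem dyadic_side_pos (Q : AxisCube n) (j : ℕ) : 0 < Q.side / 2 ^ j :=
  div_pos Q.side_pos (by positivity)

theorem mem_dyadic {Q : AxisCube n} {j : ℕ} {x y : Fin n → ℝ} :
    y ∈ (Q.dyadic j x).toSet ↔ ∀ i, ⌊(y i - Q.corner i) / (Q.side / 2 ^ j)⌋ =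
      ⌊(x i - Q.corner i) / (Q.side / 2 ^ j)⌋ := by
  rw [mem_toSet]
  refine forall_congr' fun i => ?_
  rw [Int.floor_eq_iff, le_div_iff₀ (Q.dyadic_side_pos j), div_lt_iff₀ (Q.dyadic_side_pos j)]
  simp only [dyadic]
  constructor <;> rintro ⟨h1, h2⟩ <;> constructor <;> linarith

theorem self_mem_dyadic (Q : AxisCube n) (j : ℕ) (x : Fin n → ℝ) : x ∈ (Q.dyadic j x).toSet :=
  mem_dyadic.2 fun _ => rfl

theorem dyadic_eq_of_mem {Q : AxisCube n} {j : ℕ} {x y : Fin n → ℝ}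
    (h : y ∈ (Q.dyadic j x).toSet) : Q.dyadic j y = Q.dyadic j x := by
  rw [mem_dyadic] at h
  simp only [dyadic, h]

/-- The grid index of a generation is the integer half of the next one; this is what makes the
generations nested. -/
theorem floor_dyadic_succ (Q : AxisCube n) (j : ℕ) (x : Fin n → ℝ) (i : Fin n) :
    ⌊(x i - Q.corner i) / (Q.side / 2 ^ j)⌋ =
      ⌊(x i - Q.corner i) / (Q.side / 2 ^ (j + 1))⌋ / (2 : ℕ) := by
  rw [← Int.floor_div_natCast]
  congr 1
  have := Q.side_pos
  field_simp
  push_cast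
  ring

theorem dyadic_succ_subset (Q : AxisCube n) (j : ℕ) (x : Fin n → ℝ) :
    (Q.dyadic (j + 1) x).toSet ⊆ (Q.dyadic j x).toSet := by
  intro y hy
  rw [mem_dyadic] at hy ⊢
  intro i
  rw [floor_dyadic_succ Q j x, floor_dyadic_succ Q j y, hy i]

theorem dyadic_antitone (Q : AxisCube n) (x : Fin n → ℝ) :
    Antitone fun j => (Q.dyadic j x).toSet :=
  antitone_nat_of_succ_le fun j => Q.dyadic_succ_subset j x

theorem dyadic_zero {Q : AxisCube n} {x : Fin n → ℝ} (hx : x ∈ Q.toSet) : Q.dyadic 0 x = Q := by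
  rw [mem_toSet] at hx
  have : ∀ i, ⌊(x i - Q.corner i) / (Q.side / 2 ^ 0)⌋ = 0 := by
    intro i
    have := Q.side_pos
    have := hx i
    rw [Int.floor_eq_iff, pow_zero, div_one, le_div_iff₀ Q.side_pos, div_lt_iff₀ Q.side_pos]
    push_cast
    constructor <;> linarith
  cases Q
  simp only [dyadic, mk.injEq]
  constructor
  · funext i
    simp only at this
    rw [this]
    simp
  · simp

theorem dyadic_subset {Q : AxisCube n} {x : Fin n → ℝ} (hx : x ∈ Q.toSet) (j : ℕ) :
    (Q.dyadic j x).toSet ⊆ Q.toSet := by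
  have := Q.dyadic_antitone x (Nat.zero_le j)
  simpa only [dyadic_zero hx] using this

/-- Maximal dyadic subcubes of `Q` with a given property. -/
theorem exists_stopping (Q : AxisCube n) (S : AxisCube n → Prop) :
    ∃ U : Set (AxisCube n), U.PairwiseDisjoint toSet ∧
      (∀ R ∈ U, R.toSet ⊆ Q.toSet ∧ S R ∧ (R = Q ∨ ∃ T : AxisCube n,
        R.toSet ⊆ T.toSet ∧ T.toSet ⊆ Q.toSet ∧ T.side = 2 * R.side ∧ ¬ S T)) ∧
      ∀ x ∈ Q.toSet, (∃ j, S (Q.dyadic j x)) → ∃ R ∈ U, x ∈ R.toSet := by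
  classical
  refine ⟨{R | ∃ x ∈ Q.toSet, ∃ j, R = Q.dyadic j x ∧ S R ∧ ∀ i < j, ¬ S (Q.dyadic i x)},
    ?_, ?_, ?_⟩
  · rintro R ⟨x, -, j, rfl, hj, hj'⟩ R' ⟨y, -, k, rfl, hk, hk'⟩ hne
    by_contra hcon
    obtain ⟨z, hzx, hzy⟩ := Set.not_disjoint_iff.1 hcon
    apply hne
    -- Up to its own generation, each of the two cubes has the same ancestors as the common point
    -- `z`. The finer cube would thus have an ancestor with property `S`, against its minimality.
    have e1 := fun i (hi : i ≤ j) => dyadic_eq_of_mem (Q.dyadic_antitone x hi hzx)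
    have e2 := fun i (hi : i ≤ k) => dyadic_eq_of_mem (Q.dyadic_antitone y hi hzy)
    rcases lt_trichotomy j k with h | h | h
    · exact absurd hj (by rw [← e1 j le_rfl, e2 j h.le]; exact hk' j h)
    · subst h
      rw [← e1 j le_rfl, e2 j le_rfl]
    · exact absurd hk (by rw [← e2 k le_rfl, e1 k h.le]; exact hj' k h)
  · rintro R ⟨x, hx, j, rfl, hj, hj'⟩
    refine ⟨dyadic_subset hx j, hj, ?_⟩
    rcases j with _ | j
    · exact Or.inl (dyadic_zero hx)
    · refine Or.inr ⟨Q.dyadic j x, Q.dyadic_succ_subset j x, dyadic_subset hx j, ?_,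
        hj' j (Nat.lt_succ_self j)⟩
      simp only [dyadic]
      rw [pow_succ]
      field_simp
  · rintro x hx hex
    exact ⟨_, ⟨x, hx, Nat.find hex, rfl, Nat.find_spec hex, fun i hi => Nat.find_min hex hi⟩,
      Q.self_mem_dyadic _ x⟩

/-! ### Density points along dyadic cubes -/

theorem toSet_ae_eq_closedBall (Q : AxisCube n) : Q.toSet =ᵐ[volume]
    Metric.closedBall (fun i => Q.corner i + Q.side / 2) (Q.side / 2) := by
  have h : Metric.closedBall (fun i => Q.corner i + Q.side / 2) (Q.side / 2) =
      Icc Q.corner (fun i => Q.corner i + Q.side) := by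
    rw [closedBall_pi _ (by linarith [Q.side_pos]), ← pi_univ_Icc]
    congr 1
    funext i
    rw [Real.closedBall_eq_Icc]
    congr 1 <;> ring
  rw [h]
  exact Measure.univ_pi_Ico_ae_eq_Icc

/-- Almost every point of a set is a density point along the dyadic subcubes of `Q`. -/
theorem ae_tendsto_dyadic_density (Q : AxisCube n) (S : Set (Fin n → ℝ)) :
    ∀ᵐ x ∂volume.restrict S, Filter.Tendsto
      (fun j => volume (S ∩ (Q.dyadic j x).toSet) / volume (Q.dyadic j x).toSet)
      Filter.atTop (nhds 1) := by
  -- Cubes are sup-norm balls up to null sets. The balls need not be centred at `x`: the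
  -- differentiation theorem with factor `1` only asks that `x` lie in each closed ball.
  filter_upwards [IsUnifLocDoublingMeasure.ae_tendsto_measure_inter_div volume S 1] with x hx
  have key := hx (l := Filter.atTop (α := ℕ))
    (fun j i => (Q.dyadic j x).corner i + (Q.dyadic j x).side / 2)
    (fun j => (Q.dyadic j x).side / 2) ?_ ?_
  · refine key.congr fun j => ?_
    have hae := (Q.dyadic j x).toSet_ae_eq_closedBall
    rw [measure_congr hae, measure_congr ((Filter.EventuallyEq.refl _ S).inter hae)]
  · rw [tendsto_nhdsWithin_iff]
    constructor
    · have h0 : Filter.Tendsto (fun j : ℕ => Q.side / 2 * (1 / 2 : ℝ) ^ j) Filter.atTop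
          (nhds (Q.side / 2 * 0)) :=
        (tendsto_pow_atTop_nhds_zero_of_lt_one (by norm_num) (by norm_num)).const_mul _
      rw [mul_zero] at h0
      refine h0.congr fun j => ?_
      simp only [dyadic, one_div, inv_pow]
      field_simp
    · exact Filter.Eventually.of_forall fun j => half_pos (Q.dyadic j x).side_pos
  · refine Filter.Eventually.of_forall fun j => ?_
    have := Q.self_mem_dyadic j x
    rw [mem_toSet] at this
    have hs := (Q.dyadic j x).side_pos
    rw [one_mul, closedBall_pi _ (by linarith)]
    intro i _
    have := this i
    simp only [Real.closedBall_eq_Icc]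
    constructor <;> linarith

/-- For almost every `x ∈ S` some dyadic subcube containing `x` meets `S` in a given proportion. -/
theorem ae_exists_dyadic_density (Q : AxisCube n) (S : Set (Fin n → ℝ)) {a : ℝ≥0∞} (ha : a < 1) :
    ∀ᵐ x ∂volume.restrict S, ∃ j,
      a * volume (Q.dyadic j x).toSet ≤ volume (S ∩ (Q.dyadic j x).toSet) := by
  filter_upwards [Q.ae_tendsto_dyadic_density S] with x hx
  obtain ⟨j, hj⟩ := (hx.eventually (lt_mem_nhds ha)).exists
  refine ⟨j, ?_⟩
  rw [← ENNReal.le_div_iff_mul_le (Or.inl (volume_ne_zero _)) (Or.inl (volume_ne_top _))]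
  exact hj.le

end AxisCube

/-! ### Modulars of constants on sets -/

/-- A measurable real exponent with values in `[1, P]`. -/
structure BddExponent {n : ℕ} (q : (Fin n → ℝ) → ℝ) (P : ℝ) : Prop where
  measurable : Measurable q
  one_le : ∀ x, 1 ≤ q x
  le : ∀ x, q x ≤ P

/-- The modular `∫_E s ^ q(x) dx` of a constant on a set. -/
noncomputable def wt {n : ℕ} (q : (Fin n → ℝ) → ℝ) (s : ℝ≥0) (E : Set (Fin n → ℝ)) : ℝ≥0∞ :=
  ∫⁻ x in E, (s : ℝ≥0∞) ^ q x

section wt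

variable {n : ℕ} {q : (Fin n → ℝ) → ℝ} {P : ℝ}

theorem BddExponent.nonneg (hq : BddExponent q P) (x : Fin n → ℝ) : 0 ≤ q x :=
  zero_le_one.trans (hq.one_le x)

theorem BddExponent.one_le_bound (hq : BddExponent q P) : 1 ≤ P :=
  (hq.one_le 0).trans (hq.le 0)

theorem BddExponent.measurable_rpow (hq : BddExponent q P) (s : ℝ≥0∞) :
    Measurable fun x => s ^ q x :=
  measurable_const.pow hq.measurable

theorem wt_mono_set (s : ℝ≥0) {E F : Set (Fin n → ℝ)} (h : E ⊆ F) : wt q s E ≤ wt q s F :=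
  lintegral_mono_set h

theorem wt_union_le (s : ℝ≥0) (E F : Set (Fin n → ℝ)) :
    wt q s (E ∪ F) ≤ wt q s E + wt q s F :=
  lintegral_union_le _ _ _

theorem wt_iUnion_le {ι : Type*} [Countable ι] (s : ℝ≥0) (E : ι → Set (Fin n → ℝ)) :
    wt q s (⋃ i, E i) ≤ ∑' i, wt q s (E i) :=
  lintegral_iUnion_le _ _

theorem wt_iUnion {ι : Type*} [Countable ι] (s : ℝ≥0) {E : ι → Set (Fin n → ℝ)}
    (hE : ∀ i, MeasurableSet (E i)) (hd : Pairwise (Function.onFun Disjoint E)) :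
    wt q s (⋃ i, E i) = ∑' i, wt q s (E i) :=
  lintegral_iUnion hE hd _

theorem tsum_wt_le {ι : Type*} [Countable ι] (s : ℝ≥0) {E : ι → Set (Fin n → ℝ)}
    {F : Set (Fin n → ℝ)} (hE : ∀ i, MeasurableSet (E i))
    (hd : Pairwise (Function.onFun Disjoint E)) (hF : ∀ i, E i ⊆ F) :
    ∑' i, wt q s (E i) ≤ wt q s F := by
  rw [← wt_iUnion s hE hd]
  exact wt_mono_set s (iUnion_subset hF)

theorem wt_le_of_forall {s : ℝ≥0} {E : Set (Fin n → ℝ)} (hE : MeasurableSet E) {B : ℝ≥0∞}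
    (h : ∀ x ∈ E, (s : ℝ≥0∞) ^ q x ≤ B) : wt q s E ≤ B * volume E := by
  rw [← setLIntegral_const]
  exact setLIntegral_mono' hE h

theorem le_wt_of_forall {s : ℝ≥0} {E : Set (Fin n → ℝ)} (hE : MeasurableSet E) {B : ℝ≥0∞}
    (h : ∀ x ∈ E, B ≤ (s : ℝ≥0∞) ^ q x) : B * volume E ≤ wt q s E := by
  rw [← setLIntegral_const]
  exact setLIntegral_mono' hE h

theorem BddExponent.wt_mul_le_of_forall (hq : BddExponent q P) {r s : ℝ≥0}
    {E : Set (Fin n → ℝ)} (hE : MeasurableSet E) {B : ℝ≥0∞}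
    (h : ∀ x ∈ E, (r : ℝ≥0∞) ^ q x ≤ B) : wt q (r * s) E ≤ B * wt q s E := by
  rw [wt, wt, ← lintegral_const_mul _ (hq.measurable_rpow _)]
  refine setLIntegral_mono' hE fun x hx => ?_
  rw [ENNReal.coe_mul, ENNReal.mul_rpow_of_nonneg _ _ (hq.nonneg x)]
  gcongr
  exact h x hx

theorem BddExponent.wt_mul_le (hq : BddExponent q P) {r s : ℝ≥0} (E : Set (Fin n → ℝ)) {B : ℝ≥0∞}
    (h : ∀ x, (r : ℝ≥0∞) ^ q x ≤ B) : wt q (r * s) E ≤ B * wt q s E := by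
  rw [wt, wt, ← lintegral_const_mul _ (hq.measurable_rpow _)]
  refine lintegral_mono fun x => ?_
  simp only [ENNReal.coe_mul]
  rw [ENNReal.mul_rpow_of_nonneg _ _ (hq.nonneg x)]
  gcongr
  exact h x

theorem BddExponent.wt_mul_le_rpow (hq : BddExponent q P) {r s : ℝ≥0} (hr : 1 ≤ r)
    (E : Set (Fin n → ℝ)) : wt q (r * s) E ≤ (r : ℝ≥0∞) ^ P * wt q s E :=
  hq.wt_mul_le E fun x => ENNReal.rpow_le_rpow_of_exponent_le (by exact_mod_cast hr) (hq.le x)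

theorem BddExponent.wt_mul_le_mul (hq : BddExponent q P) {r s : ℝ≥0} (hr : r ≤ 1)
    (E : Set (Fin n → ℝ)) : wt q (r * s) E ≤ (r : ℝ≥0∞) * wt q s E :=
  hq.wt_mul_le E fun x => by
    simpa using ENNReal.rpow_le_rpow_of_exponent_ge (x := (r : ℝ≥0∞)) (by exact_mod_cast hr)
      (hq.one_le x)

theorem BddExponent.rpow_le (hq : BddExponent q P) (s : ℝ≥0) (x : Fin n → ℝ) :
    (s : ℝ≥0∞) ^ q x ≤ ((max 1 s : ℝ≥0) : ℝ≥0∞) ^ P := by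
  refine le_trans (ENNReal.rpow_le_rpow (z := q x) (y := ((max 1 s : ℝ≥0) : ℝ≥0∞)) ?_
    (hq.nonneg x)) ?_
  · exact_mod_cast le_max_right _ _
  · exact ENNReal.rpow_le_rpow_of_exponent_le (by exact_mod_cast le_max_left _ _) (hq.le x)

theorem BddExponent.le_rpow (hq : BddExponent q P) (s : ℝ≥0) (x : Fin n → ℝ) :
    ((min 1 s : ℝ≥0) : ℝ≥0∞) ^ P ≤ (s : ℝ≥0∞) ^ q x := by
  refine le_trans ?_ (ENNReal.rpow_le_rpow (z := q x) (x := ((min 1 s : ℝ≥0) : ℝ≥0∞)) ?_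
    (hq.nonneg x))
  · exact ENNReal.rpow_le_rpow_of_exponent_ge (by exact_mod_cast min_le_left _ _) (hq.le x)
  · exact_mod_cast min_le_right _ _

theorem BddExponent.wt_le_volume (hq : BddExponent q P) (s : ℝ≥0) (E : Set (Fin n → ℝ)) :
    wt q s E ≤ ((max 1 s : ℝ≥0) : ℝ≥0∞) ^ P * volume E := by
  rw [← setLIntegral_const]
  exact lintegral_mono fun x => hq.rpow_le s x

theorem BddExponent.volume_le_wt (hq : BddExponent q P) (s : ℝ≥0) (E : Set (Fin n → ℝ)) :
    ((min 1 s : ℝ≥0) : ℝ≥0∞) ^ P * volume E ≤ wt q s E := by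
  rw [← setLIntegral_const]
  exact lintegral_mono fun x => hq.le_rpow s x

theorem BddExponent.wt_ne_top (hq : BddExponent q P) (s : ℝ≥0) {E : Set (Fin n → ℝ)}
    (hE : volume E ≠ ∞) : wt q s E ≠ ∞ := by
  refine ne_top_of_le_ne_top (ENNReal.mul_ne_top ?_ hE) (hq.wt_le_volume s E)
  exact ENNReal.rpow_ne_top_of_nonneg (zero_le_one.trans hq.one_le_bound) ENNReal.coe_ne_top

theorem min_rpow_ne_zero {s : ℝ≥0} (hs : 0 < s) (P : ℝ) :
    ((min 1 s : ℝ≥0) : ℝ≥0∞) ^ P ≠ 0 := by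
  have : 0 < min 1 s := lt_min one_pos hs
  exact (ENNReal.rpow_pos (by exact_mod_cast this) ENNReal.coe_ne_top).ne'

theorem BddExponent.wt_pos (hq : BddExponent q P) {s : ℝ≥0} (hs : 0 < s) {E : Set (Fin n → ℝ)}
    (hE : volume E ≠ 0) : 0 < wt q s E :=
  lt_of_lt_of_le (pos_iff_ne_zero.2 (mul_ne_zero (min_rpow_ne_zero hs P) hE))
    (hq.volume_le_wt s E)

end wt

/-! ### Modular domination over disjoint cubes -/

/-- For disjoint cubes `Q i` and admissible subsets `E i`, a bound `1` for the modular of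
`∑ c_i χ_{E_i}` yields the bound `K` for the modular of `∑ c_i χ_{Q_i}`. -/
def ModDom {n : ℕ} (q : (Fin n → ℝ) → ℝ) (rel : AxisCube n → Set (Fin n → ℝ) → Prop)
    (K : ℝ≥0) : Prop :=
  ∀ (ι : Type) [Countable ι] (Q : ι → AxisCube n) (c : ι → ℝ≥0) (E : ι → Set (Fin n → ℝ)),
    Pairwise (Function.onFun Disjoint fun i => (Q i).toSet) →
    (∀ i, MeasurableSet (E i) ∧ E i ⊆ (Q i).toSet ∧ rel (Q i) (E i)) →
    ∑' i, wt q (c i) (E i) ≤ 1 → ∑' i, wt q (c i) (Q i).toSet ≤ K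

/-- `E` occupies at least the proportion `η` of `Q`. -/
def Occupies {n : ℕ} (η : ℝ≥0) (Q : AxisCube n) (E : Set (Fin n → ℝ)) : Prop :=
  (η : ℝ≥0∞) * volume Q.toSet ≤ volume E

/-- `E` occupies at least the proportion `η` of a subcube of at least half the side length. -/
def HalfOccupies {n : ℕ} (η : ℝ≥0) (Q : AxisCube n) (E : Set (Fin n → ℝ)) : Prop :=
  ∃ R : AxisCube n, R.toSet ⊆ Q.toSet ∧ Q.side ≤ 2 * R.side ∧ Occupies η R (E ∩ R.toSet)

section ModDom

variable {n : ℕ} {q : (Fin n → ℝ) → ℝ} {P : ℝ}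

/-- Dividing the constants by `B` divides the modular by at least `B`, as `q ≥ 1`; undoing this on
the cubes costs at most `B ^ P`, as `q ≤ P`. -/
theorem ModDom.of_le {rel : AxisCube n → Set (Fin n → ℝ) → Prop} {K : ℝ≥0}
    (hq : BddExponent q P) (h : ModDom q rel K) {B : ℝ≥0} (hB : 1 ≤ B)
    {ι : Type} [Countable ι] {Q : ι → AxisCube n} {c : ι → ℝ≥0} {E : ι → Set (Fin n → ℝ)}
    (hd : Pairwise (Function.onFun Disjoint fun i => (Q i).toSet))
    (hE : ∀ i, MeasurableSet (E i) ∧ E i ⊆ (Q i).toSet ∧ rel (Q i) (E i))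
    (hs : ∑' i, wt q (c i) (E i) ≤ B) :
    ∑' i, wt q (c i) (Q i).toSet ≤ (B ^ P * K : ℝ≥0) := by
  have hB0 : B ≠ 0 := (zero_lt_one.trans_le hB).ne'
  have h1 : ∑' i, wt q (B⁻¹ * c i) (E i) ≤ 1 := by
    calc ∑' i, wt q (B⁻¹ * c i) (E i) ≤ ∑' i, ((B⁻¹ : ℝ≥0) : ℝ≥0∞) * wt q (c i) (E i) :=
          ENNReal.tsum_le_tsum fun i => hq.wt_mul_le_mul (inv_le_one_of_one_le₀ hB) _
      _ = ((B⁻¹ : ℝ≥0) : ℝ≥0∞) * ∑' i, wt q (c i) (E i) := ENNReal.tsum_mul_left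
      _ ≤ ((B⁻¹ : ℝ≥0) : ℝ≥0∞) * B := by gcongr
      _ = 1 := by rw [← ENNReal.coe_mul, inv_mul_cancel₀ hB0, ENNReal.coe_one]
  have h2 := h ι Q (fun i => B⁻¹ * c i) E hd hE h1
  calc ∑' i, wt q (c i) (Q i).toSet
      ≤ ∑' i, (B : ℝ≥0∞) ^ P * wt q (B⁻¹ * c i) (Q i).toSet := by
        refine ENNReal.tsum_le_tsum fun i => ?_
        have := hq.wt_mul_le_rpow (s := B⁻¹ * c i) hB (Q i).toSet
        rwa [← mul_assoc, mul_inv_cancel₀ hB0, one_mul] at this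
    _ = (B : ℝ≥0∞) ^ P * ∑' i, wt q (B⁻¹ * c i) (Q i).toSet := ENNReal.tsum_mul_left
    _ ≤ (B : ℝ≥0∞) ^ P * K := by gcongr
    _ = (B ^ P * K : ℝ≥0) := by
        rw [ENNReal.coe_mul, ENNReal.coe_rpow_of_ne_zero hB0]

theorem ModDom.single {rel : AxisCube n → Set (Fin n → ℝ) → Prop} {K : ℝ≥0}
    (h : ModDom q rel K) {Q : AxisCube n} {s : ℝ≥0} {E : Set (Fin n → ℝ)}
    (hm : MeasurableSet E) (hE : E ⊆ Q.toSet) (hr : rel Q E) (h1 : wt q s E ≤ 1) :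
    wt q s Q.toSet ≤ K := by
  have := h Unit (fun _ => Q) (fun _ => s) (fun _ => E)
    (fun i j hij => absurd (Subsingleton.elim i j) hij) (fun _ => ⟨hm, hE, hr⟩)
  simp only [tsum_fintype, Finset.univ_unique, Finset.sum_singleton] at this
  exact this h1

/-! ### Interpolation between nested cubes -/

theorem AxisCube.corner_le_of_subset {R Q : AxisCube n} (h : R.toSet ⊆ Q.toSet) (i : Fin n) :
    Q.corner i ≤ R.corner i :=
  (AxisCube.mem_toSet.1 (h R.corner_mem) i).1

theorem AxisCube.corner_add_side_le_of_subset {R Q : AxisCube n} (h : R.toSet ⊆ Q.toSet)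
    (i : Fin n) : R.corner i + R.side ≤ Q.corner i + Q.side := by
  refine le_of_forall_pos_le_add fun ε hε => ?_
  have hs := R.side_pos
  have hmem : (fun j => R.corner j + (R.side - min ε R.side)) ∈ R.toSet := by
    rw [AxisCube.mem_toSet]
    intro j
    have h1 := min_le_right ε R.side
    have h2 : 0 < min ε R.side := lt_min hε hs
    constructor <;> linarith
  have := (AxisCube.mem_toSet.1 (h hmem) i).2
  linarith [min_le_left ε R.side]

/-- The cubes interpolating linearly between `R` (`t = 0`) and `Q` (`t = 1`). -/
def AxisCube.interp (R Q : AxisCube n) (t : ℝ) (h0 : 0 ≤ t) (h1 : t ≤ 1) : AxisCube n where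
  corner i := (1 - t) * R.corner i + t * Q.corner i
  side := (1 - t) * R.side + t * Q.side
  side_pos := by
    rcases h0.eq_or_lt with rfl | h
    · simpa using R.side_pos
    · have := mul_pos h Q.side_pos
      have := mul_nonneg (sub_nonneg.2 h1) R.side_pos.le
      linarith

theorem AxisCube.interp_mono {R Q : AxisCube n} (h : R.toSet ⊆ Q.toSet) {t u : ℝ}
    (ht0 : 0 ≤ t) (ht1 : t ≤ 1) (hu0 : 0 ≤ u) (hu1 : u ≤ 1) (htu : t ≤ u) :
    (R.interp Q t ht0 ht1).toSet ⊆ (R.interp Q u hu0 hu1).toSet := by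
  intro x hx
  rw [AxisCube.mem_toSet] at hx ⊢
  intro i
  have h1 := AxisCube.corner_le_of_subset h i
  have h2 := AxisCube.corner_add_side_le_of_subset h i
  obtain ⟨h3, h4⟩ := hx i
  simp only [AxisCube.interp] at h3 h4 ⊢
  constructor
  · nlinarith [mul_nonneg (sub_nonneg.2 htu) (sub_nonneg.2 h1)]
  · nlinarith [mul_nonneg (sub_nonneg.2 htu) (sub_nonneg.2 h2)]

theorem AxisCube.interp_zero (R Q : AxisCube n) (h0 : (0 : ℝ) ≤ 0) (h1 : (0 : ℝ) ≤ 1) :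
    R.interp Q 0 h0 h1 = R := by
  cases R
  simp [AxisCube.interp]

theorem AxisCube.interp_one (R Q : AxisCube n) (h0 : (0 : ℝ) ≤ 1) (h1 : (1 : ℝ) ≤ 1) :
    R.interp Q 1 h0 h1 = Q := by
  cases Q
  simp [AxisCube.interp]

theorem exists_nat_pow_mul_le_one (n : ℕ) {lam : ℝ} (h1 : lam < 1) :
    ∃ m : ℕ, 0 < m ∧ lam * (1 + 1 / (m : ℝ)) ^ n ≤ 1 := by
  have : Filter.Tendsto (fun m : ℕ => lam * (1 + 1 / (m : ℝ)) ^ n) Filter.atTop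
      (nhds (lam * (1 + 0) ^ n)) :=
    ((tendsto_one_div_atTop_nhds_zero_nat.const_add 1).pow n).const_mul lam
  simp only [add_zero, one_pow, mul_one] at this
  obtain ⟨m, hm, hm'⟩ := ((this.eventually (gt_mem_nhds h1)).and
    (Filter.eventually_gt_atTop 0)).exists
  exact ⟨m, hm', hm.le⟩

/-- Domination passes from large subsets of a cube to large subsets of a half-size subcube. -/
theorem ModDom.halfOccupies (hq : BddExponent q P) {lam K : ℝ≥0} (hlam : lam < 1)
    (h : ModDom q (Occupies lam) K) : ∃ K', ModDom q (HalfOccupies lam) K' := by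
  -- With `m` steps from `R` to `Q`, each cube fills at least the proportion `lam` of the next, so
  -- domination applies `m` times, the constant changing from `K'` to at most `max (K' ^ P * K) 1`.
  obtain ⟨m, hm, hm'⟩ := exists_nat_pow_mul_le_one n (lam := lam) (by exact_mod_cast hlam)
  have hm0 : (0 : ℝ) < m := by exact_mod_cast hm
  have h0 (j : ℕ) : (0 : ℝ) ≤ j / m := by positivity
  have h1 (j : ℕ) (hj : j ≤ m) : (j / m : ℝ) ≤ 1 := by
    rw [div_le_one hm0]
    exact_mod_cast hj
  have key (j : ℕ) (hj : j ≤ m) : ∃ K' : ℝ≥0, 1 ≤ K' ∧ ∀ (ι : Type) [Countable ι]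
      (Q R : ι → AxisCube n) (c : ι → ℝ≥0) (E : ι → Set (Fin n → ℝ)),
      Pairwise (Function.onFun Disjoint fun i => (Q i).toSet) →
      (∀ i, MeasurableSet (E i) ∧ (R i).toSet ⊆ (Q i).toSet ∧ (Q i).side ≤ 2 * (R i).side ∧
        Occupies lam (R i) (E i ∩ (R i).toSet)) →
      ∑' i, wt q (c i) (E i) ≤ 1 →
      ∑' i, wt q (c i) ((R i).interp (Q i) (j / m) (h0 j) (h1 j hj)).toSet ≤ K' := by
    induction j with
    | zero =>
      refine ⟨max K 1, le_max_right _ _, fun ι _ Q R c E hd hE hs => ?_⟩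
      have hint (i : ι) : (R i).interp (Q i) ((0 : ℕ) / m) (h0 0) (h1 0 hj) = R i := by
        simp only [Nat.cast_zero, zero_div, AxisCube.interp_zero]
      simp only [hint]
      refine (h ι R c (fun i => E i ∩ (R i).toSet) (fun i k hik => ?_) (fun i => ?_) ?_).trans
        (by exact_mod_cast le_max_left _ _)
      · exact (hd hik).mono (hE i).2.1 (hE k).2.1
      · exact ⟨(hE i).1.inter (R i).measurableSet_toSet, inter_subset_right, (hE i).2.2.2⟩
      · exact (ENNReal.tsum_le_tsum fun i => wt_mono_set _ inter_subset_left).trans hs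
    | succ j ih =>
      obtain ⟨K', hK', hK⟩ := ih (by omega)
      refine ⟨max (K' ^ P * K) 1, le_max_right _ _, fun ι _ Q R c E hd hE hs => ?_⟩
      have hjm : j ≤ m := by omega
      have hle : (j / m : ℝ) ≤ ((j + 1 : ℕ) : ℝ) / m := by
        gcongr
        exact Nat.le_succ j
      refine (h.of_le hq hK' (E := fun i => ((R i).interp (Q i) (j / m) (h0 j) (h1 j hjm)).toSet)
        (fun i k hik => ?_) (fun i => ⟨AxisCube.measurableSet_toSet _, ?_, ?_⟩)
        (hK ι Q R c E hd hE hs)).trans (by exact_mod_cast le_max_left _ _)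
      · have hsub (i : ι) : ((R i).interp (Q i) ((j + 1 : ℕ) / m) (h0 _) (h1 _ hj)).toSet ⊆
            (Q i).toSet := by
          have := AxisCube.interp_mono (hE i).2.1 (h0 _) (h1 _ hj) zero_le_one le_rfl (h1 _ hj)
          rwa [AxisCube.interp_one] at this
        exact (hd hik).mono (hsub i) (hsub k)
      · exact AxisCube.interp_mono (hE i).2.1 _ _ _ _ hle
      · obtain ⟨-, -, hside, -⟩ := hE i
        have hR := (R i).side_pos
        have hQ := (Q i).side_pos
        rw [Occupies, AxisCube.volume_toSet, AxisCube.volume_toSet]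
        set a := ((R i).interp (Q i) (j / m) (h0 j) (h1 j hjm)).side with ha
        set b := ((R i).interp (Q i) ((j + 1 : ℕ) / m) (h0 _) (h1 _ hj)).side with hb
        have ha0 : 0 < a := AxisCube.side_pos _
        have hb0 : 0 < b := AxisCube.side_pos _
        -- The half-size condition bounds the whole increment by the side of `R`, hence by `a`; one
        -- step then enlarges the side by a factor at most `1 + 1/m`.
        have hRa : (Q i).side - (R i).side ≤ a := by
          by_cases hc : (R i).side ≤ (Q i).side
          · have : a = (R i).side + (j / m) * ((Q i).side - (R i).side) := by
              rw [ha]; simp only [AxisCube.interp]; ring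
            nlinarith [mul_nonneg (h0 j) (sub_nonneg.2 hc)]
          · linarith
        have hba : b ≤ (1 + 1 / (m : ℝ)) * a := by
          have : b = a + 1 / m * ((Q i).side - (R i).side) := by
            rw [ha, hb]; simp only [AxisCube.interp]; push_cast; ring
          rw [this]
          have : 1 / (m : ℝ) * ((Q i).side - (R i).side) ≤ 1 / m * a := by gcongr
          linarith
        have hreal : (lam : ℝ) * b ^ n ≤ a ^ n := by
          calc (lam : ℝ) * b ^ n ≤ lam * ((1 + 1 / (m : ℝ)) * a) ^ n := by gcongr
            _ = (lam * (1 + 1 / (m : ℝ)) ^ n) * a ^ n := by rw [mul_pow]; ring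
            _ ≤ 1 * a ^ n := by gcongr
            _ = a ^ n := one_mul _
        rw [← ENNReal.ofReal_coe_nnreal, ← ENNReal.ofReal_pow hb0.le, ← ENNReal.ofReal_pow ha0.le,
          ← ENNReal.ofReal_mul lam.coe_nonneg]
        exact ENNReal.ofReal_le_ofReal hreal
  obtain ⟨K', -, hK⟩ := key m le_rfl
  refine ⟨K', fun ι _ Q c E hd hE hs => ?_⟩
  choose R hR using fun i => (hE i).2.2
  have := hK ι Q R c E hd (fun i => ⟨(hE i).1, hR i⟩) hs
  have hint (i : ι) : (R i).interp (Q i) (m / m) (h0 m) (h1 m le_rfl) = Q i := by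
    simp only [div_self hm0.ne', AxisCube.interp_one]
  simpa only [hint] using this

/-- Stopping cubes that capture almost all of `E` and have total measure at least `|E| / lam`. -/
theorem exists_halfOccupies_cover {lam : ℝ≥0} (hlam : lam < 1) (Q : AxisCube n)
    {E : Set (Fin n → ℝ)} (hE : MeasurableSet E) (hEQ : E ⊆ Q.toSet) :
    ∃ U : Set (AxisCube n), U.PairwiseDisjoint AxisCube.toSet ∧
      (∀ R ∈ U, R.toSet ⊆ Q.toSet ∧ HalfOccupies lam R (E ∩ R.toSet)) ∧
      ((volume Q.toSet ≤ volume (⋃ R : U, (R : AxisCube n).toSet)) ∨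
        volume E ≤ lam * volume (⋃ R : U, (R : AxisCube n).toSet)) := by
  obtain ⟨U, hd, hU, hc⟩ := Q.exists_stopping fun R => HalfOccupies lam R (E ∩ R.toSet)
  refine ⟨U, hd, fun R hR => ⟨(hU R hR).1, (hU R hR).2.1⟩, ?_⟩
  -- Density `lam` in a cube makes both the cube and its dyadic parent satisfy the stopping
  -- condition. A stopping cube other than `Q` has a parent that fails it, so `E` has density at
  -- most `lam` in it.
  have hself (T R : AxisCube n) (hRT : R.toSet ⊆ T.toSet) (hs : T.side ≤ 2 * R.side)
      (ho : Occupies lam R (E ∩ R.toSet)) : HalfOccupies lam T (E ∩ T.toSet) := by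
    refine ⟨R, hRT, hs, ?_⟩
    rwa [inter_assoc, inter_eq_self_of_subset_right hRT]
  by_cases hQ : Q ∈ U
  · exact Or.inl (measure_mono (subset_iUnion (fun R : U => (R : AxisCube n).toSet) ⟨Q, hQ⟩))
  right
  have hcount : Countable U := (AxisCube.countable_of_pairwiseDisjoint hd).to_subtype
  have hd' : Pairwise (Function.onFun Disjoint fun R : U => (R : AxisCube n).toSet) :=
    fun R T hRT => hd R.2 T.2 fun h => hRT (Subtype.ext h)
  have hsmall (R : U) : volume (E ∩ (R : AxisCube n).toSet) ≤
      lam * volume (R : AxisCube n).toSet := by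
    obtain ⟨-, -, h | ⟨T, hRT, -, hs, hT⟩⟩ := hU R R.2
    · exact absurd (h ▸ R.2) hQ
    · by_contra hcon
      exact hT (hself T R hRT hs.le (not_le.1 hcon).le)
  have hcov : E ≤ᵐ[volume] ⋃ R : U, E ∩ (R : AxisCube n).toSet := by
    have := Q.ae_exists_dyadic_density E (a := lam) (by exact_mod_cast hlam)
    rw [ae_restrict_iff' hE] at this
    filter_upwards [this] with x hx hxE
    obtain ⟨j, hj⟩ := hx hxE
    obtain ⟨R, hR, hxR⟩ := hc x (hEQ hxE) ⟨j, hself _ _ subset_rfl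
      (by linarith [(Q.dyadic j x).side_pos]) hj⟩
    exact mem_iUnion.2 ⟨⟨R, hR⟩, hxE, hxR⟩
  calc volume E ≤ volume (⋃ R : U, E ∩ (R : AxisCube n).toSet) := measure_mono_ae hcov
    _ ≤ ∑' R : U, volume (E ∩ (R : AxisCube n).toSet) := measure_iUnion_le _
    _ ≤ ∑' R : U, lam * volume (R : AxisCube n).toSet := ENNReal.tsum_le_tsum hsmall
    _ = lam * volume (⋃ R : U, (R : AxisCube n).toSet) := by
      rw [ENNReal.tsum_mul_left, measure_iUnion hd' fun R => AxisCube.measurableSet_toSet _]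

/-- Domination is used twice. `h'` carries the bound from `E` to the union of its stopping cubes.
That union either fills `Q` or has measure at least `|E| / lam`, so it occupies the proportion `η`
and `h` carries the bound on to `Q`. -/
theorem ModDom.occupies_mul (hq : BddExponent q P) {lam η K K' : ℝ≥0} (hlam : lam < 1)
    (hlam0 : 0 < lam) (hη : η ≤ 1) (h : ModDom q (Occupies η) K)
    (h' : ModDom q (HalfOccupies lam) K') : ∃ K'', ModDom q (Occupies (lam * η)) K'' := by
  refine ⟨(max K' 1) ^ P * K, fun ι _ Q c E hd hE hs => ?_⟩
  choose U hUd hU hUv using fun i =>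
    exists_halfOccupies_cover hlam (Q i) (hE i).1 (hE i).2.1
  have hcount (i : ι) : Countable (U i) :=
    (AxisCube.countable_of_pairwiseDisjoint (hUd i)).to_subtype
  have hd' (i : ι) : Pairwise (Function.onFun Disjoint fun R : U i => (R : AxisCube n).toSet) :=
    fun R T hRT => hUd i R.2 T.2 fun h => hRT (Subtype.ext h)
  have step : ∑' i, wt q (c i) (⋃ R : U i, (R : AxisCube n).toSet) ≤ K' := by
    have := h' (Σ i, U i) (fun z => z.2) (fun z => c z.1)
      (fun z => E z.1 ∩ (z.2 : AxisCube n).toSet) ?_ ?_ ?_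
    · rw [ENNReal.tsum_sigma'] at this
      refine le_of_eq_of_le (tsum_congr fun i => ?_) this
      exact wt_iUnion _ (fun R => AxisCube.measurableSet_toSet _) (hd' i)
    · rintro ⟨i, R⟩ ⟨k, T⟩ hne
      by_cases hik : i = k
      · subst hik
        exact hd' i fun h => hne (congrArg (Sigma.mk i) h)
      · exact (hd hik).mono (hU i R R.2).1 (hU k T T.2).1
    · rintro ⟨i, R⟩
      exact ⟨(hE i).1.inter (AxisCube.measurableSet_toSet _), inter_subset_right,
        (hU i R R.2).2⟩
    · rw [ENNReal.tsum_sigma']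
      refine (ENNReal.tsum_le_tsum fun i => ?_).trans hs
      exact tsum_wt_le (c i) (fun R => (hE i).1.inter (AxisCube.measurableSet_toSet _))
        (fun R T hRT => (hd' i hRT).mono inter_subset_right inter_subset_right)
        fun R => inter_subset_left
  refine h.of_le hq (le_max_right K' 1) hd
    (E := fun i => ⋃ R : U i, (R : AxisCube n).toSet) (fun i => ⟨?_, ?_, ?_⟩)
    (step.trans (by exact_mod_cast le_max_left _ _))
  · exact MeasurableSet.iUnion fun R => AxisCube.measurableSet_toSet _
  · exact iUnion_subset fun R => (hU i R R.2).1
  · rw [Occupies]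
    rcases hUv i with hv | hv
    · refine le_trans ?_ hv
      exact mul_le_of_le_one_left' (by exact_mod_cast hη)
    · have h3 := ((hE i).2.2 : _ ≤ _).trans hv
      rw [ENNReal.coe_mul, mul_assoc] at h3
      exact (ENNReal.mul_le_mul_iff_right (by exact_mod_cast hlam0.ne') ENNReal.coe_ne_top).1 h3

/-- Self-improvement: domination for some proportion implies it for every proportion. -/
theorem ModDom.exists_forall (hq : BddExponent q P) {lam K : ℝ≥0} (hlam : lam < 1)
    (hlam0 : 0 < lam) (h : ModDom q (Occupies lam) K) {η : ℝ≥0} (hη : 0 < η) :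
    ∃ K', ModDom q (Occupies η) K' := by
  obtain ⟨K₁, h₁⟩ := h.halfOccupies hq hlam
  have key (j : ℕ) : ∃ K', ModDom q (Occupies (lam ^ (j + 1))) K' := by
    induction j with
    | zero => exact ⟨K, by simpa using h⟩
    | succ j ih =>
      obtain ⟨K₂, h₂⟩ := ih
      rw [pow_succ']
      exact h₂.occupies_mul hq hlam hlam0 (pow_le_one₀ zero_le hlam.le) h₁
  obtain ⟨j, hj⟩ := exists_pow_lt_of_lt_one hη hlam
  obtain ⟨K', hK'⟩ := key j
  refine ⟨K', fun ι _ Q c E hd hE hs => hK' ι Q c E hd (fun i => ⟨(hE i).1, (hE i).2.1, ?_⟩) hs⟩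
  refine le_trans ?_ (hE i).2.2
  gcongr
  exact (pow_le_pow_of_le_one zero_le hlam.le (Nat.le_succ j)).trans hj.le

end ModDom

/-! ### Quantiles -/

/-- `r` is the largest level with `ν {r ≤ g} ≥ c`: it is attained by continuity from above, and
continuity from below handles `{r < g}`. Both sets are needed because `{g = r}` may carry mass. -/
theorem exists_quantile {α : Type*} [MeasurableSpace α] (ν : Measure α) [IsFiniteMeasure ν]
    {g : α → ℝ} (hg : Measurable g) {a b : ℝ} (ha : ∀ x, a ≤ g x) (hb : ∀ x, g x ≤ b)
    {c : ℝ≥0∞} (hc0 : 0 < c) (hc : c ≤ ν univ) :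
    ∃ r, c ≤ ν {x | r ≤ g x} ∧ ν {x | r < g x} ≤ c := by
  set S : Set ℝ := {r | c ≤ ν {x | r ≤ g x}} with hS
  have hne : S.Nonempty := ⟨a, by simpa [hS, ha] using hc⟩
  have hbdd : BddAbove S := by
    refine ⟨b, fun r hr => ?_⟩
    by_contra hcon
    have : {x | r ≤ g x} = ∅ :=
      eq_empty_of_forall_notMem fun x hx => hcon (le_trans hx (hb x))
    simp only [hS, mem_ofPred_eq, this, measure_empty] at hr
    exact absurd hr (not_le.2 hc0)
  have hpos (k : ℕ) : (0 : ℝ) < 1 / ((k : ℝ) + 1) := by positivity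
  refine ⟨sSup S, ?_, ?_⟩
  · have hI : {x | sSup S ≤ g x} = ⋂ k : ℕ, {x | sSup S - 1 / ((k : ℝ) + 1) ≤ g x} := by
      ext x
      simp only [mem_ofPred_eq, mem_iInter]
      refine ⟨fun h k => by linarith [hpos k], fun h => ?_⟩
      refine le_of_forall_pos_le_add fun ε hε => ?_
      obtain ⟨k, hk⟩ := exists_nat_one_div_lt hε
      linarith [h k]
    rw [hI, Antitone.measure_iInter]
    · refine le_iInf fun k => ?_
      obtain ⟨r, hr, hlt⟩ := exists_lt_of_lt_csSup hne (sub_lt_self (sSup S) (hpos k))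
      exact le_trans hr (measure_mono fun x (hx : r ≤ g x) => hlt.le.trans hx)
    · intro i j hij x hx
      have hx' : sSup S - 1 / ((j : ℝ) + 1) ≤ g x := hx
      have : 1 / ((j : ℝ) + 1) ≤ 1 / ((i : ℝ) + 1) := by gcongr
      exact le_trans (by linarith) hx'
    · exact fun k => (measurableSet_le measurable_const hg).nullMeasurableSet
    · exact ⟨0, measure_ne_top _ _⟩
  · have hU : {x | sSup S < g x} = ⋃ k : ℕ, {x | sSup S + 1 / ((k : ℝ) + 1) ≤ g x} := by
      ext x
      simp only [mem_ofPred_eq, mem_iUnion]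
      refine ⟨fun h => ?_, fun ⟨k, hk⟩ => by linarith [hpos k]⟩
      obtain ⟨k, hk⟩ := exists_nat_one_div_lt (sub_pos.2 h)
      exact ⟨k, by linarith⟩
    rw [hU, Monotone.measure_iUnion]
    · refine iSup_le fun k => ?_
      by_contra hcon
      have : sSup S + 1 / ((k : ℝ) + 1) ∈ S := (not_le.1 hcon).le
      linarith [le_csSup hbdd this, hpos k]
    · intro i j hij x hx
      have hx' : sSup S + 1 / ((i : ℝ) + 1) ≤ g x := hx
      have : 1 / ((j : ℝ) + 1) ≤ 1 / ((i : ℝ) + 1) := by gcongr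
      exact le_trans (by linarith) hx'

/-! ### Comparing a cube with its large subsets -/

section Good

variable {n : ℕ} {q : (Fin n → ℝ) → ℝ} {P : ℝ}

theorem AxisCube.exists_quantile (Q : AxisCube n) {g : (Fin n → ℝ) → ℝ} (hg : Measurable g)
    {a b : ℝ} (ha : ∀ x, a ≤ g x) (hb : ∀ x, g x ≤ b) {θ : ℝ≥0} (h0 : 0 < θ) (h1 : θ ≤ 1) :
    ∃ r, Occupies θ Q (Q.toSet ∩ {x | r ≤ g x}) ∧
      volume (Q.toSet ∩ {x | r < g x}) ≤ θ * volume Q.toSet := by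
  have : IsFiniteMeasure (volume.restrict Q.toSet) := ⟨by
    rw [Measure.restrict_apply_univ]; exact Q.volume_ne_top.lt_top⟩
  obtain ⟨r, h2, h3⟩ := VarExp.exists_quantile (volume.restrict Q.toSet) hg ha hb
    (c := θ * volume Q.toSet)
    (ENNReal.mul_pos (by exact_mod_cast h0.ne') Q.volume_ne_zero)
    (by
      rw [Measure.restrict_apply_univ]
      exact mul_le_of_le_one_left' (by exact_mod_cast h1))
  rw [Measure.restrict_apply (measurableSet_le measurable_const hg), inter_comm] at h2
  rw [Measure.restrict_apply (measurableSet_lt measurable_const hg), inter_comm] at h3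
  exact ⟨r, h2, h3⟩

theorem Occupies.diff {η : ℝ≥0} {Q : AxisCube n} {E F : Set (Fin n → ℝ)} (hEQ : E ⊆ Q.toSet)
    (h : Occupies η Q E) (hF : volume (Q.toSet ∩ F) ≤ (η / 2 : ℝ≥0) * volume Q.toSet) :
    Occupies (η / 2) Q (E ∩ Fᶜ) := by
  have h1 : volume E ≤ volume (E ∩ Fᶜ) + (η / 2 : ℝ≥0) * volume Q.toSet := by
    calc volume E ≤ volume ((E ∩ Fᶜ) ∪ (Q.toSet ∩ F)) := by
          refine measure_mono fun x hx => ?_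
          by_cases hxF : x ∈ F
          · exact Or.inr ⟨hEQ hx, hxF⟩
          · exact Or.inl ⟨hx, hxF⟩
      _ ≤ _ := (measure_union_le _ _).trans (by gcongr)
  have h2 : ((η / 2 : ℝ≥0) : ℝ≥0∞) * volume Q.toSet + (η / 2 : ℝ≥0) * volume Q.toSet ≤
      volume (E ∩ Fᶜ) + (η / 2 : ℝ≥0) * volume Q.toSet := by
    refine le_trans (le_of_eq ?_) (le_trans h h1)
    rw [← add_mul, ← ENNReal.coe_add, add_halves]
  exact (ENNReal.add_le_add_iff_right
    (ENNReal.mul_ne_top ENNReal.coe_ne_top Q.volume_ne_top)).1 h2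

theorem Occupies.mono {η θ : ℝ≥0} {Q : AxisCube n} {E : Set (Fin n → ℝ)} (h : Occupies η Q E)
    (hθ : θ ≤ η) : Occupies θ Q E :=
  le_trans (by gcongr) h

theorem Occupies.volume_ne_zero {η : ℝ≥0} (hη : 0 < η) {Q : AxisCube n} {E : Set (Fin n → ℝ)}
    (h : Occupies η Q E) : volume E ≠ 0 :=
  (lt_of_lt_of_le (ENNReal.mul_pos (by exact_mod_cast hη.ne') Q.volume_ne_zero) h).ne'

/-- Rescaling the constant by `r` moves the modular on `E` to at most `1`; domination then controls
the modular off `E`. -/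
theorem ModDom.wt_diff_le {θ K : ℝ≥0} (hq : BddExponent q P) (h : ModDom q (Occupies θ) K)
    {Q : AxisCube n} {s r e : ℝ≥0} {E : Set (Fin n → ℝ)} (hm : MeasurableSet E)
    (hEQ : E ⊆ Q.toSet) (ho : Occupies θ Q E) (he : wt q s E = e) (he0 : 0 < e) (hr : 0 < r)
    (h1 : ∀ x ∈ E, (r : ℝ≥0∞) ^ q x ≤ (e⁻¹ : ℝ≥0))
    (h2 : ∀ x ∈ Q.toSet \ E, ((r⁻¹ : ℝ≥0) : ℝ≥0∞) ^ q x ≤ e) :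
    wt q s (Q.toSet \ E) ≤ K * wt q s E := by
  have h3 : wt q (r * s) E ≤ 1 := by
    refine (hq.wt_mul_le_of_forall hm h1).trans (le_of_eq ?_)
    rw [he, ← ENNReal.coe_mul, inv_mul_cancel₀ he0.ne', ENNReal.coe_one]
  have h4 := h.single hm hEQ ho h3
  have h5 := hq.wt_mul_le_of_forall (s := r * s) (Q.measurableSet_toSet.diff hm) h2
  rw [← mul_assoc, inv_mul_cancel₀ hr.ne', one_mul] at h5
  refine h5.trans ?_
  rw [he, mul_comm]
  gcongr
  exact (wt_mono_set _ sdiff_subset).trans h4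

/-- `m` is the factor that would turn modular `e` into `1` if the exponent were constantly `r`.
Whether `m ≥ 1` or `m ≤ 1` decides on which side of `r` the true exponents must lie for
`ModDom.wt_diff_le`. -/
theorem exists_scale {e : ℝ≥0} (he : 0 < e) {r : ℝ} (hr : 0 < r) :
    ∃ m : ℝ≥0, 0 < m ∧ (e ≤ 1 → 1 ≤ m) ∧ (1 ≤ e → m ≤ 1) ∧ (m : ℝ≥0∞) ^ r = (e⁻¹ : ℝ≥0) ∧
      ((m⁻¹ : ℝ≥0) : ℝ≥0∞) ^ r = e := by
  have hm : (e⁻¹ ^ (1 / r)) ≠ 0 := (NNReal.rpow_pos (inv_pos.2 he)).ne'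
  have hpow : (e⁻¹ ^ (1 / r)) ^ r = e⁻¹ := by
    rw [← NNReal.rpow_mul, one_div, inv_mul_cancel₀ hr.ne', NNReal.rpow_one]
  refine ⟨e⁻¹ ^ (1 / r), pos_iff_ne_zero.2 hm, fun h => ?_, fun h => ?_, ?_, ?_⟩
  · exact NNReal.one_le_rpow ((one_le_inv₀ he).2 h) (by positivity)
  · exact NNReal.rpow_le_one (inv_le_one_of_one_le₀ h) (by positivity)
  · rw [← ENNReal.coe_rpow_of_ne_zero hm, hpow]
  · rw [← ENNReal.coe_rpow_of_ne_zero (inv_ne_zero hm), NNReal.inv_rpow, hpow, inv_inv]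

/-- Both modulars are compared with the constant `s ^ r`: it bounds the integrand from above on `E`
and from below on `G`, and `G` fills the proportion `η / 2` of `Q`. -/
theorem wt_le_two_div_mul {η : ℝ≥0} (hη : 0 < η) {Q : AxisCube n} {s : ℝ≥0} {r : ℝ}
    {E G : Set (Fin n → ℝ)} (hE : MeasurableSet E) (hG : MeasurableSet G) (hEQ : E ⊆ Q.toSet)
    (h1 : ∀ x ∈ E, (s : ℝ≥0∞) ^ q x ≤ (s : ℝ≥0∞) ^ r)
    (h2 : ∀ x ∈ G, (s : ℝ≥0∞) ^ r ≤ (s : ℝ≥0∞) ^ q x) (ho : Occupies (η / 2) Q G) :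
    wt q s E ≤ (2 / η : ℝ≥0) * wt q s G := by
  have hη2 : (2 / η : ℝ≥0) * (η / 2) = 1 := by
    field_simp
  calc wt q s E ≤ (s : ℝ≥0∞) ^ r * volume E := wt_le_of_forall hE h1
    _ ≤ (s : ℝ≥0∞) ^ r * volume Q.toSet := by gcongr
    _ = (2 / η : ℝ≥0) * ((s : ℝ≥0∞) ^ r * ((η / 2 : ℝ≥0) * volume Q.toSet)) := by
      rw [mul_left_comm, ← mul_assoc ((2 / η : ℝ≥0) : ℝ≥0∞), ← ENNReal.coe_mul, hη2,
        ENNReal.coe_one, one_mul]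
    _ ≤ (2 / η : ℝ≥0) * ((s : ℝ≥0∞) ^ r * volume G) := by gcongr; exact ho
    _ ≤ (2 / η : ℝ≥0) * wt q s G := by gcongr; exact le_wt_of_forall hG h2

theorem wt_le_of_wt_diff_le {η K : ℝ≥0} {Q : AxisCube n} {s : ℝ≥0}
    {E F : Set (Fin n → ℝ)} (h1 : wt q s (Q.toSet \ E) ≤ K * wt q s E)
    (h2 : wt q s E ≤ (2 / η : ℝ≥0) * wt q s F) :
    wt q s Q.toSet ≤ ((K + 1) * (2 / η) : ℝ≥0) * wt q s F := by
  calc wt q s Q.toSet ≤ wt q s (Q.toSet \ E) + wt q s E := by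
        refine le_trans (wt_mono_set s ?_) (wt_union_le s _ _)
        rw [sdiff_union_self]
        exact subset_union_left
    _ ≤ K * wt q s E + 1 * wt q s E := by rw [one_mul]; gcongr
    _ = ((K + 1 : ℝ≥0) : ℝ≥0∞) * wt q s E := by rw [← add_mul]; simp
    _ ≤ ((K + 1 : ℝ≥0) : ℝ≥0∞) * ((2 / η : ℝ≥0) * wt q s F) := by gcongr
    _ = ((K + 1) * (2 / η) : ℝ≥0) * wt q s F := by rw [← mul_assoc, ← ENNReal.coe_mul]

/-- For constants at least `1`, the modular on a cube is comparable to that on large subsets. -/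
theorem ModDom.wt_le_of_one_le (hq : BddExponent q P) {η K : ℝ≥0} (hη : 0 < η) (hη1 : η ≤ 1)
    (h : ModDom q (Occupies (η / 2)) K) {Q : AxisCube n} {s : ℝ≥0} (hs : 1 ≤ s)
    {F : Set (Fin n → ℝ)} (hF : MeasurableSet F) (hFQ : F ⊆ Q.toSet) (ho : Occupies η Q F)
    (hsm : wt q s F ≤ (η / 2 : ℝ≥0)) :
    wt q s Q.toSet ≤ ((K + 1) * (2 / η) : ℝ≥0) * wt q s F := by
  have hs' : (1 : ℝ≥0∞) ≤ s := by exact_mod_cast hs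
  -- For `s ≥ 1` the set `E` collects the small exponents, `q ≤ -r`, where `s ^ q` is small. At most
  -- the proportion `η / 2` has `q < -r`, so `F` keeps the proportion `η / 2` where `s ^ q` is at
  -- least `s ^ (-r)`.
  obtain ⟨r, hr1, hr2⟩ := Q.exists_quantile (g := fun x => - q x) (a := -P) (b := -1)
    hq.measurable.neg (fun x => neg_le_neg (hq.le x)) (fun x => neg_le_neg (hq.one_le x))
    (half_pos hη)
    ((half_le_self zero_le).trans hη1)
  set E := Q.toSet ∩ {x | r ≤ - q x} with hE
  have hEm : MeasurableSet E :=
    Q.measurableSet_toSet.inter (measurableSet_le measurable_const hq.measurable.neg)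
  have hGm : MeasurableSet (F ∩ {x | r < - q x}ᶜ) :=
    hF.inter (measurableSet_lt measurable_const hq.measurable.neg).compl
  have h1 : wt q s E ≤ (2 / η : ℝ≥0) * wt q s F := by
    refine (wt_le_two_div_mul (r := -r) hη hEm hGm inter_subset_left (fun x hx => ?_)
      (fun x hx => ?_) (ho.diff hFQ hr2)).trans ?_
    · exact ENNReal.rpow_le_rpow_of_exponent_le hs' (by have : r ≤ - q x := hx.2; linarith)
    · refine ENNReal.rpow_le_rpow_of_exponent_le hs' ?_
      have : ¬ r < - q x := hx.2
      linarith
    · gcongr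
      exact wt_mono_set s inter_subset_left
  have hle1 : wt q s E ≤ 1 := by
    refine h1.trans ?_
    calc ((2 / η : ℝ≥0) : ℝ≥0∞) * wt q s F ≤ (2 / η : ℝ≥0) * (η / 2 : ℝ≥0) := by gcongr
      _ = 1 := by
        rw [← ENNReal.coe_mul, ← ENNReal.coe_one]
        congr 1
        field_simp
  have hEv := hr1.volume_ne_zero (half_pos hη)
  have hpos := hq.wt_pos (lt_of_lt_of_le one_pos hs) hEv
  obtain ⟨e, he⟩ : ∃ e : ℝ≥0, (e : ℝ≥0∞) = wt q s E :=
    ⟨_, ENNReal.coe_toNNReal (ne_top_of_le_ne_top ENNReal.one_ne_top hle1)⟩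
  have he0 : 0 < e := by
    rw [← he] at hpos
    exact_mod_cast hpos
  have he1 : e ≤ 1 := by
    rw [← he] at hle1
    exact_mod_cast hle1
  have hr : 0 < -r := by
    obtain ⟨x, hx⟩ := nonempty_of_measure_ne_zero hEv
    have : r ≤ - q x := hx.2
    linarith [hq.one_le x]
  -- Since `e ≤ 1`, also `m ≥ 1`: then `m ^ q ≤ 1 / e` where `q ≤ -r`, and `(1 / m) ^ q ≤ e` where
  -- `q > -r`.
  obtain ⟨m, hm0, hm1, -, hm2, hm3⟩ := exists_scale he0 hr
  refine wt_le_of_wt_diff_le (h.wt_diff_le hq hEm inter_subset_left hr1 he.symm he0 hm0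
    (fun x hx => ?_) (fun x hx => ?_)) h1
  · rw [← hm2]
    exact ENNReal.rpow_le_rpow_of_exponent_le (by exact_mod_cast hm1 he1)
      (by have : r ≤ - q x := hx.2; linarith)
  · rw [← hm3]
    refine ENNReal.rpow_le_rpow_of_exponent_ge
      (by exact_mod_cast inv_le_one_of_one_le₀ (hm1 he1)) ?_
    have : ¬ r ≤ - q x := fun h => hx.2 ⟨hx.1, h⟩
    linarith

/-- For constants at most `1`, the modular on a cube is comparable to that on large subsets,
unless it is bounded by `K`. -/
theorem ModDom.wt_le_of_le_one (hq : BddExponent q P) {η K : ℝ≥0} (hη : 0 < η) (hη1 : η ≤ 1)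
    (h : ModDom q (Occupies (η / 2)) K) {Q : AxisCube n} {s : ℝ≥0} (hs0 : 0 < s) (hs : s ≤ 1)
    (hbig : K < wt q s Q.toSet)
    {F : Set (Fin n → ℝ)} (hF : MeasurableSet F) (hFQ : F ⊆ Q.toSet) (ho : Occupies η Q F) :
    wt q s Q.toSet ≤ ((K + 1) * (2 / η) : ℝ≥0) * wt q s F := by
  have hs' : (s : ℝ≥0∞) ≤ 1 := by exact_mod_cast hs
  obtain ⟨r, hr1, hr2⟩ := Q.exists_quantile hq.measurable hq.one_le hq.le (half_pos hη)
    ((half_le_self zero_le).trans hη1)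
  set E := Q.toSet ∩ {x | r ≤ q x} with hE
  have hEm : MeasurableSet E :=
    Q.measurableSet_toSet.inter (measurableSet_le measurable_const hq.measurable)
  have hGm : MeasurableSet (F ∩ {x | r < q x}ᶜ) :=
    hF.inter (measurableSet_lt measurable_const hq.measurable).compl
  have h1 : wt q s E ≤ (2 / η : ℝ≥0) * wt q s F := by
    refine (wt_le_two_div_mul (r := r) hη hEm hGm inter_subset_left (fun x hx => ?_)
      (fun x hx => ?_) (ho.diff hFQ hr2)).trans ?_
    · exact ENNReal.rpow_le_rpow_of_exponent_ge hs' hx.2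
    · exact ENNReal.rpow_le_rpow_of_exponent_ge hs' (not_lt.1 hx.2)
    · gcongr
      exact wt_mono_set s inter_subset_left
  have hEv := hr1.volume_ne_zero (half_pos hη)
  have hpos := hq.wt_pos hs0 hEv
  obtain ⟨e, he⟩ : ∃ e : ℝ≥0, (e : ℝ≥0∞) = wt q s E :=
    ⟨_, ENNReal.coe_toNNReal (hq.wt_ne_top s
      (ne_top_of_le_ne_top Q.volume_ne_top (measure_mono (inter_subset_left : E ⊆ Q.toSet))))⟩
  have he0 : 0 < e := by
    rw [← he] at hpos
    exact_mod_cast hpos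
  -- Modular below `1` on `E` would force modular at most `K` on `Q`. The inequality `e ≥ 1` makes
  -- the scale `m ≤ 1`, which fits the set of large exponents chosen here.
  have he1 : 1 ≤ e := by
    by_contra hcon
    refine absurd hbig (not_lt.2 (h.single hEm inter_subset_left hr1 ?_))
    rw [← he]
    exact_mod_cast (not_le.1 hcon).le
  rcases le_or_gt r 0 with hr0 | hr
  · have : Q.toSet \ E = ∅ := by
      rw [sdiff_eq_empty]
      exact fun x hx => ⟨hx, hr0.trans (hq.nonneg x)⟩
    refine wt_le_of_wt_diff_le (E := E) ?_ h1
    rw [this]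
    simp [wt]
  obtain ⟨m, hm0, -, hm1, hm2, hm3⟩ := exists_scale he0 hr
  refine wt_le_of_wt_diff_le (h.wt_diff_le hq hEm inter_subset_left hr1 he.symm he0 hm0
    (fun x hx => ?_) (fun x hx => ?_)) h1
  · rw [← hm2]
    exact ENNReal.rpow_le_rpow_of_exponent_ge (by exact_mod_cast hm1 he1) hx.2
  · rw [← hm3]
    refine ENNReal.rpow_le_rpow_of_exponent_le
      (by exact_mod_cast (one_le_inv₀ hm0).2 (hm1 he1)) ?_
    exact (not_le.1 fun h => hx.2 ⟨hx.1, h⟩).le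

/-! ### Bad cubes -/

/-- A cube is bad at level `s` if its modular is not controlled by that of some large subset. -/
def Bad (q : (Fin n → ℝ) → ℝ) (η A s : ℝ≥0) (Q : AxisCube n) : Prop :=
  ∃ E, MeasurableSet E ∧ E ⊆ Q.toSet ∧ Occupies η Q E ∧ A * wt q s E < wt q s Q.toSet

/-- By `ModDom.wt_le_of_le_one`, comparability can fail only on cubes of modular at most `K`. -/
theorem Bad.wt_le (hq : BddExponent q P) {η K A s : ℝ≥0} (hη : 0 < η) (hη1 : η ≤ 1)
    (h : ModDom q (Occupies (η / 2)) K) (hA : (K + 1) * (2 / η) ≤ A) (hs0 : 0 < s) (hs : s ≤ 1)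
    {Q : AxisCube n} (hb : Bad q η A s Q) : wt q s Q.toSet ≤ K := by
  obtain ⟨E, hE, hEQ, ho, hlt⟩ := hb
  by_contra hcon
  have := h.wt_le_of_le_one hq hη hη1 hs0 hs (not_le.1 hcon) hE hEQ ho
  refine absurd hlt (not_lt.2 (this.trans ?_))
  gcongr

/-- A bootstrap over finite subfamilies. If the total so far is at most `K`, one more cube makes it
at most `2 * K`; by badness the witnesses then have total at most `2 * K / A ≤ 1` (when `A ≠ 0`),
and domination returns the enlarged total to `K`. -/
theorem tsum_wt_bad_le {η K A s : ℝ≥0} (h : ModDom q (Occupies η) K) (hA : 2 * K ≤ A)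
    {ι : Type} {Q : ι → AxisCube n}
    (hd : Pairwise (Function.onFun Disjoint fun i => (Q i).toSet))
    (hb : ∀ i, Bad q η A s (Q i)) (hK : ∀ i, wt q s (Q i).toSet ≤ K) :
    ∑' i, wt q s (Q i).toSet ≤ K := by
  classical
  choose E hE hEQ ho hlt using hb
  rw [ENNReal.tsum_eq_iSup_sum]
  refine iSup_le fun t => ?_
  induction t using Finset.induction_on with
  | empty => simp
  | insert i t hi ih =>
    have h2 : ∑ k ∈ insert i t, wt q s (Q k).toSet ≤ (2 * K : ℝ≥0) := by
      rw [Finset.sum_insert hi, ENNReal.coe_mul, ENNReal.coe_ofNat, two_mul]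
      exact add_le_add (hK i) ih
    have := h (insert i t : Finset ι) (fun k => Q k) (fun _ => s) (fun k => E k)
      (fun k l hkl => hd fun h => hkl (Subtype.ext h)) (fun k => ⟨hE k, hEQ k, ho k⟩) ?_
    · rwa [Finset.tsum_subtype (insert i t) fun k => wt q s (Q k).toSet] at this
    · rw [Finset.tsum_subtype (insert i t) fun k => wt q s (E k)]
      rcases eq_or_ne A 0 with rfl | hA0
      · have hK0 : K = 0 := by
          have := hA
          rw [nonpos_iff_eq_zero, mul_eq_zero] at this
          simpa using this
        refine le_trans (Finset.sum_le_sum fun k _ => wt_mono_set s (hEQ k)) (h2.trans ?_)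
        simp [hK0]
      have hA0' : (A : ℝ≥0∞) ≠ 0 := by exact_mod_cast hA0
      rw [← ENNReal.mul_le_mul_iff_right hA0' ENNReal.coe_ne_top, mul_one, Finset.mul_sum]
      exact (Finset.sum_le_sum fun k _ => (hlt k).le).trans (h2.trans (by exact_mod_cast hA))

theorem AxisCube.side_le_of_volume_le (hn : 0 < n) {Q : AxisCube n} {b : ℝ≥0}
    (h : volume Q.toSet ≤ b) : Q.side ≤ max 1 b := by
  by_contra hcon
  have h1 : (max 1 b : ℝ) < Q.side := not_le.1 hcon
  have h2 : Q.side ≤ Q.side ^ n :=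
    le_self_pow₀ ((le_max_left _ _).trans h1.le) hn.ne'
  rw [AxisCube.volume_toSet, ← ENNReal.ofReal_pow Q.side_pos.le,
    ← ENNReal.ofReal_coe_nnreal, ENNReal.ofReal_le_ofReal_iff b.coe_nonneg] at h
  linarith [le_max_right (1 : ℝ) b]

/-- Bounded modular gives bounded volume because `s ^ q` is bounded below by `min 1 s ^ P`. Vitali's
covering and the climbing argument for bad cubes need bounded sides. -/
theorem BddExponent.exists_side_le (hq : BddExponent q P) (hn : 0 < n) {s : ℝ≥0} (hs : 0 < s)
    {C : ℝ≥0∞} (hC : C ≠ ∞) : ∃ B : ℝ, ∀ Q : AxisCube n, wt q s Q.toSet ≤ C → Q.side ≤ B := by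
  obtain ⟨b, hb⟩ : ∃ b : ℝ≥0, (b : ℝ≥0∞) = C / ((min 1 s : ℝ≥0) : ℝ≥0∞) ^ P :=
    ⟨_, ENNReal.coe_toNNReal (ENNReal.div_ne_top hC (min_rpow_ne_zero hs P))⟩
  refine ⟨max 1 b, fun Q hQ => AxisCube.side_le_of_volume_le hn ?_⟩
  rw [hb, ENNReal.le_div_iff_mul_le (Or.inl (min_rpow_ne_zero hs P)) (Or.inr hC), mul_comm]
  exact (hq.volume_le_wt s _).trans hQ

/-- Otherwise the dilate of every bad cube containing `Q` is bad, with the smaller cube as witness: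
it fills the proportion `5⁻ⁿ ≥ η`. Iteration produces bad cubes of side exceeding `B`. -/
theorem exists_bad_doubling {η A s : ℝ≥0} (hη5 : η * 5 ^ n ≤ 1) {B : ℝ}
    (hB : ∀ Q : AxisCube n, Bad q η A s Q → Q.side ≤ B) {Q : AxisCube n} (hQ : Bad q η A s Q) :
    ∃ R, Q.toSet ⊆ R.toSet ∧ Bad q η A s R ∧ wt q s R.dilate.toSet ≤ A * wt q s R.toSet := by
  by_contra! hcon
  have key (k : ℕ) : ∃ R, Q.toSet ⊆ R.toSet ∧ Bad q η A s R ∧ 5 ^ k * Q.side ≤ R.side := by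
    induction k with
    | zero => exact ⟨Q, subset_rfl, hQ, by simp⟩
    | succ k ih =>
      obtain ⟨R, h1, h2, h3⟩ := ih
      refine ⟨R.dilate, h1.trans R.subset_dilate, ⟨R.toSet, R.measurableSet_toSet,
        R.subset_dilate, ?_, hcon R h1 h2⟩, ?_⟩
      · rw [Occupies, AxisCube.volume_dilate, ← mul_assoc]
        refine mul_le_of_le_one_left' ?_
        exact_mod_cast hη5
      · simp only [AxisCube.dilate]
        rw [pow_succ]
        linarith
  obtain ⟨k, hk⟩ := pow_unbounded_of_one_lt (B / Q.side) (by norm_num : (1 : ℝ) < 5)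
  obtain ⟨R, -, h2, h3⟩ := key k
  rw [div_lt_iff₀ Q.side_pos] at hk
  linarith [hB R h2]

/-- All bad cubes at a level `s ≤ 1` lie in a measurable set of controlled modular. -/
theorem exists_bad_cover (hq : BddExponent q P) (hn : 0 < n) {η K A s : ℝ≥0} (hη : 0 < η)
    (hη5 : η * 5 ^ n ≤ 1) (h : ModDom q (Occupies (η / 2)) K) (hA : (K + 1) * (2 / η) ≤ A)
    (hs0 : 0 < s) (hs : s ≤ 1) :
    ∃ V, MeasurableSet V ∧ (∀ Q, Bad q η A s Q → Q.toSet ⊆ V) ∧ wt q s V ≤ (A * K : ℝ≥0) := by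
  have h5 : (1 : ℝ≥0) ≤ 5 ^ n := one_le_pow₀ (by norm_num)
  have hη1 : η ≤ 1 := le_trans (le_mul_of_one_le_right' h5) hη5
  have hbK (Q : AxisCube n) (hb : Bad q η A s Q) : wt q s Q.toSet ≤ K :=
    hb.wt_le hq hη hη1 h hA hs0 hs
  obtain ⟨B, hB⟩ := hq.exists_side_le hn hs0 (C := K) ENNReal.coe_ne_top
  have hBb (Q : AxisCube n) (hb : Bad q η A s Q) : Q.side ≤ B := hB Q (hbK Q hb)
  -- Vitali is applied only to bad cubes whose dilates have comparable modular. Every bad cube lies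
  -- in one of these, so their selected dilates still cover everything.
  obtain ⟨U, hUT, hd, hc⟩ := AxisCube.exists_vitali
    {R : AxisCube n | Bad q η A s R ∧ wt q s R.dilate.toSet ≤ A * wt q s R.toSet} B
    fun R hR => hBb R hR.1
  have hcount : Countable U := (AxisCube.countable_of_pairwiseDisjoint hd).to_subtype
  have hd' : Pairwise (Function.onFun Disjoint fun R : U => (R : AxisCube n).toSet) :=
    fun R T hRT => hd R.2 T.2 fun h => hRT (Subtype.ext h)
  refine ⟨⋃ R : U, (R : AxisCube n).dilate.toSet,
    MeasurableSet.iUnion fun R => AxisCube.measurableSet_toSet _, fun Q hQ => ?_, ?_⟩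
  · obtain ⟨R, hQR, hR⟩ := exists_bad_doubling hη5 hBb hQ
    obtain ⟨T, hT, hRT⟩ := hc R hR
    exact (hQR.trans hRT).trans
      (subset_iUnion (fun R : U => (R : AxisCube n).dilate.toSet) ⟨T, hT⟩)
  · have hAK : 2 * K ≤ A := by
      refine le_trans ?_ hA
      have h2 : 2 ≤ 2 / η := by
        rw [le_div_iff₀ hη]
        exact mul_le_of_le_one_right' hη1
      calc 2 * K = K * 2 := mul_comm _ _
        _ ≤ (K + 1) * (2 / η) := mul_le_mul' (le_add_of_nonneg_right zero_le) h2
    have hmod : ModDom q (Occupies η) K := fun ι _ Q c E h1 h2 =>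
      h ι Q c E h1 fun i => ⟨(h2 i).1, (h2 i).2.1, (h2 i).2.2.mono (half_le_self zero_le)⟩
    calc wt q s (⋃ R : U, (R : AxisCube n).dilate.toSet)
        ≤ ∑' R : U, wt q s (R : AxisCube n).dilate.toSet := wt_iUnion_le _ _
      _ ≤ ∑' R : U, A * wt q s (R : AxisCube n).toSet :=
        ENNReal.tsum_le_tsum fun R => (hUT R.2).2
      _ = A * ∑' R : U, wt q s (R : AxisCube n).toSet := ENNReal.tsum_mul_left
      _ ≤ A * K := by
        gcongr
        exact tsum_wt_bad_le hmod hAK hd' (fun R => (hUT R.2).1) fun R => hbK R (hUT R.2).1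
      _ = (A * K : ℝ≥0) := (ENNReal.coe_mul _ _).symm

end Good

/-! ### Reverse Hölder inequality off an exceptional set -/

section ReverseHolder

variable {n : ℕ} {q : (Fin n → ℝ) → ℝ} {P : ℝ}

/-- The average of `s ^ q` over a cube. -/
noncomputable def cubeAvg (q : (Fin n → ℝ) → ℝ) (s : ℝ≥0) (Q : AxisCube n) : ℝ≥0∞ :=
  wt q s Q.toSet / volume Q.toSet

theorem cubeAvg_mul_volume (q : (Fin n → ℝ) → ℝ) (s : ℝ≥0) (Q : AxisCube n) :
    cubeAvg q s Q * volume Q.toSet = wt q s Q.toSet :=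
  ENNReal.div_mul_cancel Q.volume_ne_zero Q.volume_ne_top

theorem BddExponent.cubeAvg_ne_top (hq : BddExponent q P) (s : ℝ≥0) (Q : AxisCube n) :
    cubeAvg q s Q ≠ ∞ :=
  ENNReal.div_ne_top (hq.wt_ne_top s Q.volume_ne_top) Q.volume_ne_zero

theorem BddExponent.cubeAvg_ne_zero (hq : BddExponent q P) {s : ℝ≥0} (hs : 0 < s)
    (Q : AxisCube n) : cubeAvg q s Q ≠ 0 :=
  ENNReal.div_ne_zero.2 ⟨(hq.wt_pos hs Q.volume_ne_zero).ne', Q.volume_ne_top⟩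

theorem AxisCube.volume_of_side_eq {R T : AxisCube n} (h : T.side = 2 * R.side) :
    volume T.toSet = 2 ^ n * volume R.toSet := by
  rw [volume_toSet, volume_toSet, h, ENNReal.ofReal_mul (by norm_num), mul_pow]
  norm_num

theorem coe_rpow_rpow {s : ℝ≥0} (hs : 0 < s) (a b : ℝ) :
    ((s ^ a : ℝ≥0) : ℝ≥0∞) ^ b = ((s : ℝ≥0∞) ^ b) ^ a := by
  rw [ENNReal.coe_rpow_of_ne_zero hs.ne', ← ENNReal.rpow_mul, ← ENNReal.rpow_mul, mul_comm]

theorem wt_rpow_le_of_ae {s : ℝ≥0} (hs : 0 < s) {ε : ℝ} (hε : 0 ≤ ε) (hq : BddExponent q P)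
    {E : Set (Fin n → ℝ)} {B : ℝ≥0∞} (h : ∀ᵐ x ∂volume.restrict E, (s : ℝ≥0∞) ^ q x ≤ B) :
    wt q (s ^ (1 + ε)) E ≤ B ^ ε * wt q s E := by
  rw [wt, wt, ← lintegral_const_mul _ (hq.measurable_rpow _)]
  refine lintegral_mono_ae (h.mono fun x hx => ?_)
  rw [coe_rpow_rpow hs, ENNReal.rpow_add_of_nonneg _ _ zero_le_one hε, ENNReal.rpow_one, mul_comm]
  gcongr

/-- Jensen's inequality. -/
theorem wt_rpow_le_volume_mul {s : ℝ≥0} (hs : 0 < s) {ε : ℝ} (hε : 0 < ε)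
    (hq : BddExponent q P) (E : Set (Fin n → ℝ)) :
    wt q s E ^ (1 + ε) ≤ volume E ^ ε * wt q (s ^ (1 + ε)) E := by
  have h1 : (0 : ℝ) < 1 + ε := by linarith
  have hc : (1 + ε).HolderConjugate ((1 + ε) / ε) := by
    rw [Real.holderConjugate_iff]
    refine ⟨by linarith, ?_⟩
    field_simp
  have := ENNReal.lintegral_mul_le_Lp_mul_Lq (volume.restrict E) hc
    (f := fun x => (s : ℝ≥0∞) ^ q x) (g := fun _ => 1) (hq.measurable_rpow _).aemeasurable
    aemeasurable_const
  simp only [Pi.mul_apply, mul_one, ENNReal.one_rpow, lintegral_const, one_mul,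
    Measure.restrict_apply_univ] at this
  refine (ENNReal.rpow_le_rpow this h1.le).trans (le_of_eq ?_)
  rw [ENNReal.mul_rpow_of_nonneg _ _ h1.le, ← ENNReal.rpow_mul, ← ENNReal.rpow_mul, mul_comm, wt]
  congr 1
  · congr 1
    field_simp
  · rw [one_div, inv_mul_cancel₀ h1.ne', ENNReal.rpow_one]
    exact lintegral_congr fun x => (coe_rpow_rpow hs _ _).symm

/-- Stopping cubes for the average of `s ^ q` at twice its average on `R`. -/
theorem exists_calderonZygmund (hq : BddExponent q P) {s : ℝ≥0} (hs : 0 < s) (R : AxisCube n) :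
    ∃ U : Set (AxisCube n), U.PairwiseDisjoint AxisCube.toSet ∧
      (∀ T ∈ U, T.toSet ⊆ R.toSet ∧ cubeAvg q s T ≤ 2 ^ (n + 1) * cubeAvg q s R) ∧
      volume (⋃ T : U, (T : AxisCube n).toSet) ≤ 2⁻¹ * volume R.toSet ∧
      ∀ᵐ x ∂volume.restrict (R.toSet \ ⋃ T : U, (T : AxisCube n).toSet),
        (s : ℝ≥0∞) ^ q x ≤ 4 * cubeAvg q s R := by
  have ha0 := hq.cubeAvg_ne_zero hs R
  have ha1 := hq.cubeAvg_ne_top s R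
  obtain ⟨U, hd, hU, hc⟩ := R.exists_stopping fun T =>
    2 * cubeAvg q s R * volume T.toSet ≤ wt q s T.toSet
  have hcount : Countable U := (AxisCube.countable_of_pairwiseDisjoint hd).to_subtype
  have hd' : Pairwise (Function.onFun Disjoint fun T : U => (T : AxisCube n).toSet) :=
    fun T T' hT => hd T.2 T'.2 fun h => hT (Subtype.ext h)
  refine ⟨U, hd, fun T hT => ⟨(hU T hT).1, ?_⟩, ?_, ?_⟩
  · obtain ⟨-, hS, rfl | ⟨T', hTT', -, hside, hT'⟩⟩ := hU T hT
    · rw [← one_mul (cubeAvg q s T), ← mul_assoc]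
      gcongr
      rw [mul_one]
      exact one_le_pow₀ (by norm_num)
    · rw [cubeAvg, ENNReal.div_le_iff T.volume_ne_zero T.volume_ne_top]
      calc wt q s T.toSet ≤ wt q s T'.toSet := wt_mono_set s hTT'
        _ ≤ 2 * cubeAvg q s R * volume T'.toSet := (not_le.1 hT').le
        _ = 2 ^ (n + 1) * cubeAvg q s R * volume T.toSet := by
          rw [AxisCube.volume_of_side_eq hside]; ring
  · have h1 : 2 * cubeAvg q s R * volume (⋃ T : U, (T : AxisCube n).toSet) ≤
        cubeAvg q s R * volume R.toSet := by
      rw [measure_iUnion hd' fun T => AxisCube.measurableSet_toSet _, ← ENNReal.tsum_mul_left,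
        cubeAvg_mul_volume]
      exact (ENNReal.tsum_le_tsum fun T : U => (hU T T.2).2.1).trans
        (tsum_wt_le s (fun T => AxisCube.measurableSet_toSet _) hd' fun T => (hU T T.2).1)
    rw [mul_comm 2, mul_assoc, ENNReal.mul_le_mul_iff_right ha0 ha1] at h1
    rw [mul_comm, ← div_eq_mul_inv, ENNReal.le_div_iff_mul_le (Or.inl (by norm_num))
      (Or.inl (by norm_num)), mul_comm]
    exact h1
  · set S : Set (Fin n → ℝ) := R.toSet ∩ {x | 4 * cubeAvg q s R < (s : ℝ≥0∞) ^ q x} with hS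
    have hSm : MeasurableSet S :=
      R.measurableSet_toSet.inter (measurableSet_lt measurable_const (hq.measurable_rpow _))
    -- Where `s ^ q` exceeds four times the average, some dyadic cube has half its measure in that
    -- set, hence an average at least twice that of `R`, and is covered by a stopping cube.
    have hdens := R.ae_exists_dyadic_density S (a := 2⁻¹) (by norm_num)
    rw [ae_restrict_iff' hSm] at hdens
    rw [ae_restrict_iff' (R.measurableSet_toSet.diff
      (MeasurableSet.iUnion fun T => AxisCube.measurableSet_toSet _))]
    filter_upwards [hdens] with x hx hxR
    by_contra hcon
    obtain ⟨j, hj⟩ := hx ⟨hxR.1, not_le.1 hcon⟩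
    refine hxR.2 ?_
    suffices h : 2 * cubeAvg q s R * volume (R.dyadic j x).toSet ≤ wt q s (R.dyadic j x).toSet by
      obtain ⟨T, hT, hxT⟩ := hc x hxR.1 ⟨j, h⟩
      exact mem_iUnion.2 ⟨⟨T, hT⟩, hxT⟩
    calc 2 * cubeAvg q s R * volume (R.dyadic j x).toSet
        = 4 * cubeAvg q s R * (2⁻¹ * volume (R.dyadic j x).toSet) := by
          have : (2 : ℝ≥0∞) = 4 * 2⁻¹ := by
            rw [← div_eq_mul_inv, ENNReal.eq_div_iff (by norm_num) (by norm_num)]; norm_num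
          nth_rewrite 1 [this]
          ring
      _ ≤ 4 * cubeAvg q s R * volume (S ∩ (R.dyadic j x).toSet) := by gcongr
      _ ≤ wt q s (S ∩ (R.dyadic j x).toSet) :=
        le_wt_of_forall (hSm.inter (AxisCube.measurableSet_toSet _)) fun y hy => hy.1.2.le
      _ ≤ wt q s (R.dyadic j x).toSet := wt_mono_set s inter_subset_right

/-- One stopping-time step improves the constant in the reverse Hölder inequality. -/
theorem reverseHolder_step (hq : BddExponent q P) {s : ℝ≥0} (hs : 0 < s) {ε : ℝ} (hε : 0 < ε)
    {A κ X : ℝ≥0} (hκ : (2 : ℝ≥0) ^ ((n + 1 : ℕ) * ε) * (A - 1) ≤ κ * A) (hA : 1 ≤ A)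
    {V : Set (Fin n → ℝ)}
    (hgood : ∀ R : AxisCube n, ¬ R.toSet ⊆ V → ∀ E, MeasurableSet E → E ⊆ R.toSet →
      Occupies (1 / 2) R E → wt q s R.toSet ≤ A * wt q s E)
    (hX : ∀ R : AxisCube n, ¬ R.toSet ⊆ V →
      wt q (s ^ (1 + ε)) (R.toSet \ V) ≤ X * (cubeAvg q s R ^ ε * wt q s R.toSet))
    (R : AxisCube n) (hR : ¬ R.toSet ⊆ V) :
    wt q (s ^ (1 + ε)) (R.toSet \ V) ≤
      (4 ^ ε + κ * X : ℝ≥0) * (cubeAvg q s R ^ ε * wt q s R.toSet) := by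
  obtain ⟨U, hd, hU, hvol, hae⟩ := exists_calderonZygmund hq hs R
  have hcount : Countable U := (AxisCube.countable_of_pairwiseDisjoint hd).to_subtype
  have hd' : Pairwise (Function.onFun Disjoint fun T : U => (T : AxisCube n).toSet) :=
    fun T T' hT => hd T.2 T'.2 fun h => hT (Subtype.ext h)
  set W := ⋃ T : U, (T : AxisCube n).toSet with hW
  have hWm : MeasurableSet W := MeasurableSet.iUnion fun T => AxisCube.measurableSet_toSet _
  have hWR : W ⊆ R.toSet := iUnion_subset fun T => (hU T T.2).1
  have hRtop := hq.wt_ne_top s R.volume_ne_top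
  have hsplit : wt q s W + wt q s (R.toSet \ W) = wt q s R.toSet := by
    have := lintegral_inter_add_sdiff (μ := volume) (fun x => (s : ℝ≥0∞) ^ q x) R.toSet hWm
    rwa [inter_eq_self_of_subset_right hWR] at this
  have hocc : Occupies (1 / 2) R (R.toSet \ W) := by
    rw [Occupies, measure_sdiff hWR hWm.nullMeasurableSet
      (ne_top_of_le_ne_top R.volume_ne_top (measure_mono hWR))]
    refine ENNReal.le_sub_of_add_le_left
      (ne_top_of_le_ne_top R.volume_ne_top (measure_mono hWR)) ?_
    calc volume W + ((1 / 2 : ℝ≥0) : ℝ≥0∞) * volume R.toSet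
        ≤ 2⁻¹ * volume R.toSet + 2⁻¹ * volume R.toSet := by
          refine add_le_add hvol (le_of_eq ?_)
          simp
      _ = volume R.toSet := by rw [← add_mul, ENNReal.inv_two_add_inv_two, one_mul]
  -- `R \ W` fills half of `R`, so goodness gives `wt(R) ≤ A (wt(R) - wt(W))`; thus `W` carries at
  -- most the fraction `1 - 1 / A` of the modular.
  have hWle : (A : ℝ≥0∞) * wt q s W ≤ ((A - 1 : ℝ≥0) : ℝ≥0∞) * wt q s R.toSet := by
    have h1 := hgood R hR _ (R.measurableSet_toSet.diff hWm) sdiff_subset hocc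
    have h2 : (A : ℝ≥0∞) * wt q s W + wt q s R.toSet ≤
        ((A - 1 : ℝ≥0) : ℝ≥0∞) * wt q s R.toSet + wt q s R.toSet := by
      calc (A : ℝ≥0∞) * wt q s W + wt q s R.toSet
          ≤ A * wt q s W + A * wt q s (R.toSet \ W) := by gcongr
        _ = A * wt q s R.toSet := by rw [← mul_add, hsplit]
        _ = ((A - 1 + 1 : ℝ≥0) : ℝ≥0∞) * wt q s R.toSet := by rw [tsub_add_cancel_of_le hA]
        _ = _ := by rw [ENNReal.coe_add, add_mul, ENNReal.coe_one, one_mul]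
    exact (ENNReal.add_le_add_iff_right hRtop).1 h2
  have hpart (T : U) : wt q (s ^ (1 + ε)) ((T : AxisCube n).toSet \ V) ≤
      X * ((2 ^ (n + 1) * cubeAvg q s R) ^ ε * wt q s (T : AxisCube n).toSet) := by
    by_cases hT : (T : AxisCube n).toSet ⊆ V
    · rw [sdiff_eq_empty.2 hT]
      simp [wt]
    · refine (hX T hT).trans ?_
      gcongr
      exact (hU T T.2).2
  have hA0 : (A : ℝ≥0∞) ≠ 0 := by exact_mod_cast (zero_lt_one.trans_le hA).ne'
  have hsum : wt q (s ^ (1 + ε)) (W \ V) ≤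
      (κ * X : ℝ≥0) * (cubeAvg q s R ^ ε * wt q s R.toSet) := by
    calc wt q (s ^ (1 + ε)) (W \ V)
        ≤ ∑' T : U, wt q (s ^ (1 + ε)) ((T : AxisCube n).toSet \ V) := by
          rw [hW, iUnion_sdiff]
          exact wt_iUnion_le _ _
      _ ≤ ∑' T : U, X * ((2 ^ (n + 1) * cubeAvg q s R) ^ ε * wt q s (T : AxisCube n).toSet) :=
        ENNReal.tsum_le_tsum hpart
      _ = X * ((2 ^ (n + 1) * cubeAvg q s R) ^ ε * wt q s W) := by
        rw [ENNReal.tsum_mul_left, ENNReal.tsum_mul_left,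
          hW, wt_iUnion _ (fun T => AxisCube.measurableSet_toSet _) hd']
      _ = X * cubeAvg q s R ^ ε * (((2 : ℝ≥0) ^ ((n + 1 : ℕ) * ε) : ℝ≥0) * wt q s W) := by
        rw [ENNReal.mul_rpow_of_nonneg _ _ hε.le, ← ENNReal.rpow_natCast, ← ENNReal.rpow_mul,
          ENNReal.coe_rpow_of_ne_zero two_ne_zero, ENNReal.coe_ofNat]
        ring
      _ ≤ X * cubeAvg q s R ^ ε * (κ * wt q s R.toSet) := by
        refine mul_le_mul' le_rfl ?_
        refine (ENNReal.mul_le_mul_iff_right hA0 ENNReal.coe_ne_top).1 ?_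
        calc (A : ℝ≥0∞) * (((2 : ℝ≥0) ^ ((n + 1 : ℕ) * ε) : ℝ≥0) * wt q s W)
            = ((2 : ℝ≥0) ^ ((n + 1 : ℕ) * ε) : ℝ≥0) * (A * wt q s W) := by ring
          _ ≤ ((2 : ℝ≥0) ^ ((n + 1 : ℕ) * ε) : ℝ≥0) *
              (((A - 1 : ℝ≥0) : ℝ≥0∞) * wt q s R.toSet) := by gcongr
          _ = ((2 : ℝ≥0) ^ ((n + 1 : ℕ) * ε) * (A - 1) : ℝ≥0) * wt q s R.toSet := by
            rw [ENNReal.coe_mul, mul_assoc]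
          _ ≤ (κ * A : ℝ≥0) * wt q s R.toSet := by gcongr
          _ = A * (κ * wt q s R.toSet) := by rw [ENNReal.coe_mul]; ring
      _ = (κ * X : ℝ≥0) * (cubeAvg q s R ^ ε * wt q s R.toSet) := by
        rw [ENNReal.coe_mul]; ring
  have hoff : wt q (s ^ (1 + ε)) (R.toSet \ W) ≤
      (4 ^ ε : ℝ≥0) * (cubeAvg q s R ^ ε * wt q s R.toSet) := by
    refine (wt_rpow_le_of_ae hs hε.le hq hae).trans ?_
    rw [ENNReal.mul_rpow_of_nonneg _ _ hε.le, ENNReal.coe_rpow_of_ne_zero four_ne_zero,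
      ENNReal.coe_ofNat, mul_assoc]
    gcongr
    exact wt_mono_set s sdiff_subset
  calc wt q (s ^ (1 + ε)) (R.toSet \ V)
      ≤ wt q (s ^ (1 + ε)) (R.toSet \ W) + wt q (s ^ (1 + ε)) (W \ V) := by
        refine (wt_mono_set _ fun x hx => ?_).trans (wt_union_le _ _ _)
        by_cases hxW : x ∈ W
        · exact Or.inr ⟨hxW, hx.2⟩
        · exact Or.inl ⟨hx.1, hxW⟩
    _ ≤ (4 ^ ε : ℝ≥0) * (cubeAvg q s R ^ ε * wt q s R.toSet) +
        (κ * X : ℝ≥0) * (cubeAvg q s R ^ ε * wt q s R.toSet) := add_le_add hoff hsum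
    _ = _ := by rw [← add_mul, ← ENNReal.coe_add]

/-- As `ε → 0` the ratio of the left side to `A` tends to `1 - 1 / A < 1`. So the loss `2 ^ ((n + 1)
ε)` from the stopping cubes is beaten by the gain in modular. -/
theorem exists_selfImproving_exponent (n : ℕ) {A : ℝ≥0} (hA : 1 ≤ A) :
    ∃ ε : ℝ, 0 < ε ∧ ∃ κ : ℝ≥0, κ < 1 ∧ (2 : ℝ≥0) ^ ((n + 1 : ℕ) * ε) * (A - 1) ≤ κ * A := by
  have hA0 : 0 < A := zero_lt_one.trans_le hA
  have hlim : Filter.Tendsto (fun ε : ℝ => (2 : ℝ≥0) ^ ((n + 1 : ℕ) * ε) * (A - 1) / A)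
      (nhdsWithin 0 (Ioi 0)) (nhds ((2 : ℝ≥0) ^ ((n + 1 : ℕ) * (0 : ℝ)) * (A - 1) / A)) := by
    refine Filter.Tendsto.mono_left ?_ nhdsWithin_le_nhds
    have h1 : Filter.Tendsto (fun ε : ℝ => (2 : ℝ≥0) ^ ((n + 1 : ℕ) * ε)) (nhds 0)
        (nhds ((2 : ℝ≥0) ^ ((n + 1 : ℕ) * (0 : ℝ)))) :=
      Filter.Tendsto.nnrpow tendsto_const_nhds (Filter.tendsto_id.const_mul _)
        (Or.inl two_ne_zero)
    exact (h1.mul_const _).div_const _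
  have hlt : (2 : ℝ≥0) ^ ((n + 1 : ℕ) * (0 : ℝ)) * (A - 1) / A < 1 := by
    rw [mul_zero, NNReal.rpow_zero, one_mul, div_lt_one hA0]
    exact tsub_lt_self hA0 one_pos
  obtain ⟨ε, hε1, hε0⟩ := ((hlim.eventually (gt_mem_nhds hlt)).and
    self_mem_nhdsWithin).exists
  exact ⟨ε, hε0, _, hε1, le_of_eq (div_mul_cancel₀ _ hA0.ne').symm⟩

/-- Reverse Hölder inequality for `s ^ q` off the exceptional set `V`. -/
theorem reverseHolder (hq : BddExponent q P) {s : ℝ≥0} (hs : 0 < s) (hs1 : s ≤ 1) {ε : ℝ}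
    (hε : 0 < ε) {A κ : ℝ≥0} (hκ1 : κ < 1)
    (hκ : (2 : ℝ≥0) ^ ((n + 1 : ℕ) * ε) * (A - 1) ≤ κ * A) (hA : 1 ≤ A)
    {V : Set (Fin n → ℝ)}
    (hgood : ∀ R : AxisCube n, ¬ R.toSet ⊆ V → ∀ E, MeasurableSet E → E ⊆ R.toSet →
      Occupies (1 / 2) R E → wt q s R.toSet ≤ A * wt q s E)
    (R : AxisCube n) (hR : ¬ R.toSet ⊆ V) :
    wt q (s ^ (1 + ε)) (R.toSet \ V) ≤
      (4 ^ ε / (1 - κ) : ℝ≥0) * (cubeAvg q s R ^ ε * wt q s R.toSet) := by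
  -- The fixed point of `X ↦ 4 ^ ε + κ * X`, the map by which one stopping step changes the
  -- constant.
  set B : ℝ≥0 := 4 ^ ε / (1 - κ) with hB
  have hκ' : 1 - κ ≠ 0 := (tsub_pos_of_lt hκ1).ne'
  have hBfix : 4 ^ ε + κ * B = B := by
    have h1 : (1 - κ) * B = 4 ^ ε := by rw [hB, mul_div_cancel₀ _ hκ']
    rw [← h1, ← add_mul, tsub_add_cancel_of_le hκ1.le, one_mul]
  have hσP : s ^ P ≠ 0 := (NNReal.rpow_pos hs).ne'
  -- A crude starting constant from `s ^ P ≤ s ^ q ≤ 1`. It depends on `s`, but its contribution `κ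
  -- ^ j * X₀` vanishes in the limit.
  set X₀ : ℝ≥0 := (s ^ P)⁻¹ ^ ε with hX₀
  have key (j : ℕ) : ∀ R : AxisCube n, ¬ R.toSet ⊆ V → wt q (s ^ (1 + ε)) (R.toSet \ V) ≤
      (B + κ ^ j * X₀ : ℝ≥0) * (cubeAvg q s R ^ ε * wt q s R.toSet) := by
    induction j with
    | zero =>
      intro R _
      have h1 : ((s ^ P : ℝ≥0) : ℝ≥0∞) ≤ cubeAvg q s R := by
        rw [cubeAvg, ENNReal.le_div_iff_mul_le (Or.inl R.volume_ne_zero)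
          (Or.inl R.volume_ne_top), ENNReal.coe_rpow_of_ne_zero hs.ne']
        simpa [min_eq_right hs1] using hq.volume_le_wt s R.toSet
      have h2 : (1 : ℝ≥0∞) ≤ X₀ * cubeAvg q s R ^ ε := by
        calc (1 : ℝ≥0∞) = (X₀ * (s ^ P) ^ ε : ℝ≥0) := by
              rw [hX₀, ← NNReal.mul_rpow, inv_mul_cancel₀ hσP, NNReal.one_rpow, ENNReal.coe_one]
          _ = X₀ * ((s ^ P : ℝ≥0) : ℝ≥0∞) ^ ε := by
              rw [ENNReal.coe_mul, ENNReal.coe_rpow_of_ne_zero hσP]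
          _ ≤ X₀ * cubeAvg q s R ^ ε := by gcongr
      calc wt q (s ^ (1 + ε)) (R.toSet \ V) ≤ 1 ^ ε * wt q s (R.toSet \ V) := by
            refine wt_rpow_le_of_ae hs hε.le hq (Filter.Eventually.of_forall fun x => ?_)
            exact ENNReal.rpow_le_one (by exact_mod_cast hs1) (hq.nonneg x)
        _ ≤ 1 * wt q s R.toSet := by
          rw [ENNReal.one_rpow]
          gcongr
          exact wt_mono_set s sdiff_subset
        _ ≤ X₀ * cubeAvg q s R ^ ε * wt q s R.toSet := by gcongr
        _ ≤ _ := by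
          rw [mul_assoc, pow_zero, one_mul]
          gcongr
          exact le_add_of_nonneg_left zero_le
    | succ j ih =>
      intro R hR
      refine (reverseHolder_step hq hs hε hκ hA hgood ih R hR).trans (le_of_eq ?_)
      congr 2
      rw [mul_add, ← add_assoc, hBfix, pow_succ']
      ring
  have hlim : Filter.Tendsto (fun j : ℕ => ((B + κ ^ j * X₀ : ℝ≥0) : ℝ≥0∞) *
      (cubeAvg q s R ^ ε * wt q s R.toSet)) Filter.atTop
      (nhds ((B : ℝ≥0∞) * (cubeAvg q s R ^ ε * wt q s R.toSet))) := by
    refine ENNReal.Tendsto.mul_const (ENNReal.tendsto_coe.2 ?_) (Or.inr (ENNReal.mul_ne_top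
      (ENNReal.rpow_ne_top_of_nonneg hε.le (hq.cubeAvg_ne_top s R))
      (hq.wt_ne_top s R.volume_ne_top)))
    have := ((NNReal.tendsto_pow_atTop_nhds_zero_of_lt_one hκ1).mul_const X₀).const_add B
    simpa using this
  exact ge_of_tendsto' hlim fun j => key j R hR

/-- At the improved level `s ^ (1 + ε)` the modular on a cube, off the exceptional set of level
`s`, is comparable to that on large subsets. -/
theorem exists_wt_diff_le (n : ℕ) {A : ℝ≥0} (hA : 1 ≤ A) {η : ℝ≥0} (hη : η ≤ 1 / 2) (hη0 : 0 < η) :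
    ∃ ε : ℝ, 0 < ε ∧ ∃ D : ℝ≥0, ∀ (q : (Fin n → ℝ) → ℝ) (P : ℝ), BddExponent q P →
      ∀ s : ℝ≥0, 0 < s → s ≤ 1 → ∀ V : Set (Fin n → ℝ),
      (∀ Q : AxisCube n, Bad q η A s Q → Q.toSet ⊆ V) →
      ∀ (R : AxisCube n) (E : Set (Fin n → ℝ)), MeasurableSet E → E ⊆ R.toSet → Occupies η R E →
      wt q (s ^ (1 + ε)) (R.toSet \ V) ≤ D * wt q (s ^ (1 + ε)) E := by
  obtain ⟨ε, hε, κ, hκ1, hκ⟩ := exists_selfImproving_exponent n hA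
  have h1ε : (0 : ℝ) < 1 + ε := by linarith
  refine ⟨ε, hε, 4 ^ ε / (1 - κ) * A ^ (1 + ε), ?_⟩
  intro q P hq s hs hs1 V hbad R E hE hER ho
  by_cases hR : R.toSet ⊆ V
  · rw [sdiff_eq_empty.2 hR]
    simp [wt]
  have hgood (Q : AxisCube n) (hQ : ¬ Q.toSet ⊆ V) (F : Set (Fin n → ℝ)) (hF : MeasurableSet F)
      (hFQ : F ⊆ Q.toSet) (hoF : Occupies η Q F) : wt q s Q.toSet ≤ A * wt q s F :=
    not_lt.1 fun hlt => hQ (hbad Q ⟨F, hF, hFQ, hoF, hlt⟩)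
  refine (reverseHolder hq hs hs1 hε hκ1 hκ hA
    (fun Q hQ F hF hFQ hoF => hgood Q hQ F hF hFQ (hoF.mono hη)) R hR).trans ?_
  rw [ENNReal.coe_mul, mul_assoc]
  refine mul_le_mul' le_rfl ?_
  have hA0 : A ≠ 0 := (zero_lt_one.trans_le hA).ne'
  have hRv : volume R.toSet ^ ε ≠ 0 := (ENNReal.rpow_pos R.volume_pos R.volume_ne_top).ne'
  have hRv' : volume R.toSet ^ ε ≠ ∞ := ENNReal.rpow_ne_top_of_nonneg hε.le R.volume_ne_top
  refine (ENNReal.mul_le_mul_iff_right hRv hRv').1 ?_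
  -- The factor `|R| ^ ε` turns the reverse Hölder bound into `wt(R) ^ (1 + ε)`. Goodness passes to
  -- `E` at level `s`, and Jensen on `E` returns to level `s ^ (1 + ε)`.
  calc volume R.toSet ^ ε * (cubeAvg q s R ^ ε * wt q s R.toSet)
      = wt q s R.toSet ^ (1 + ε) := by
        rw [← mul_assoc, ← ENNReal.mul_rpow_of_nonneg _ _ hε.le, mul_comm (volume _),
          cubeAvg_mul_volume, ENNReal.rpow_add_of_nonneg _ _ zero_le_one hε.le, ENNReal.rpow_one,
          mul_comm]
    _ ≤ (A * wt q s E) ^ (1 + ε) := by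
        gcongr
        exact hgood R hR E hE hER ho
    _ = (A ^ (1 + ε) : ℝ≥0) * wt q s E ^ (1 + ε) := by
        rw [ENNReal.mul_rpow_of_nonneg _ _ h1ε.le, ENNReal.coe_rpow_of_ne_zero hA0]
    _ ≤ (A ^ (1 + ε) : ℝ≥0) * (volume E ^ ε * wt q (s ^ (1 + ε)) E) := by
        gcongr
        exact wt_rpow_le_volume_mul hs hε hq E
    _ ≤ (A ^ (1 + ε) : ℝ≥0) * (volume R.toSet ^ ε * wt q (s ^ (1 + ε)) E) := by gcongr
    _ = volume R.toSet ^ ε * ((A ^ (1 + ε) : ℝ≥0) * wt q (s ^ (1 + ε)) E) := by ring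

end ReverseHolder

/-! ### The modular estimate for the median maximal operator -/

section Core

variable {n : ℕ} {q : (Fin n → ℝ) → ℝ} {P : ℝ}

/-! ### Decomposition into dyadic levels -/

theorem tsum_int_eq_tsum_nat {F : ℤ → ℝ≥0∞} {j : ℤ} (hF : ∀ k, j < k → F k = 0) :
    ∑' k, F k = ∑' i : ℕ, F (j - i) := by
  have hinj : Function.Injective fun i : ℕ => j - (i : ℤ) := fun a b h => by
    have : j - (a : ℤ) = j - b := h
    omega
  refine (hinj.tsum_eq fun k hk => ?_).symm
  have : k ≤ j := not_lt.1 fun h => hk (hF k h)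
  exact ⟨(j - k).toNat, by
    show j - ((j - k).toNat : ℤ) = k
    omega⟩

/-- Counting down from the largest power of two below `a`, the terms decay at least like `2⁻ⁱ`,
because `r ≥ 1`. -/
theorem tsum_two_zpow_indicator_le {r : ℝ} (hr : 1 ≤ r) (a : ℝ≥0∞) :
    ∑' k : ℤ, (if ((2 : ℝ≥0∞) ^ k) < a then ((2 : ℝ≥0∞) ^ k) ^ r else 0) ≤ 2 * a ^ r := by
  have hr0 : 0 < r := zero_lt_one.trans_le hr
  rcases eq_or_ne a 0 with rfl | ha0
  · simp
  rcases eq_or_ne a ∞ with rfl | ha1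
  · rw [ENNReal.top_rpow_of_pos hr0, ENNReal.mul_top two_ne_zero]
    exact le_top
  obtain ⟨j, hj1, hj2⟩ := ENNReal.exists_mem_Ioc_zpow ha0 ha1 (y := 2) (by norm_num) (by norm_num)
  rw [tsum_int_eq_tsum_nat (j := j)]
  · calc ∑' i : ℕ, (if ((2 : ℝ≥0∞) ^ (j - i)) < a then ((2 : ℝ≥0∞) ^ (j - i)) ^ r else 0)
        ≤ ∑' i : ℕ, (2⁻¹ : ℝ≥0∞) ^ i * a ^ r := by
          refine ENNReal.tsum_le_tsum fun i => ?_
          refine le_trans (ite_le_sup _ _ _) (sup_le ?_ zero_le)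
          rw [ENNReal.zpow_sub two_ne_zero (by norm_num), zpow_natCast, mul_comm,
            ENNReal.mul_rpow_of_nonneg _ _ hr0.le, ENNReal.inv_pow]
          gcongr
          have : (2⁻¹ : ℝ≥0∞) ^ i ≤ 1 := pow_le_one₀ zero_le (by norm_num)
          simpa using ENNReal.rpow_le_rpow_of_exponent_ge this hr
      _ = 2 * a ^ r := by
          rw [ENNReal.tsum_mul_right, ENNReal.tsum_geometric, ENNReal.one_sub_inv_two, inv_inv]
  · intro k hk
    rw [if_neg]
    refine not_lt.2 (hj2.trans ?_)
    exact ENNReal.zpow_le_of_le (by norm_num) hk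

theorem tsum_two_zpow_rpow_ne_top {δ : ℝ} (hδ : 0 < δ) :
    ∑' k : ℤ, (if k < 0 then ((2 : ℝ≥0∞) ^ k) ^ δ else 0) ≠ ∞ := by
  rw [tsum_int_eq_tsum_nat (j := 0) fun k hk => if_neg (not_lt.2 hk.le)]
  have hlt : (2⁻¹ : ℝ≥0∞) ^ δ < 1 := ENNReal.rpow_lt_one (by norm_num) hδ
  refine ne_top_of_le_ne_top (b := ∑' i : ℕ, ((2⁻¹ : ℝ≥0∞) ^ δ) ^ i) ?_
    (ENNReal.tsum_le_tsum fun i => ?_)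
  · rw [ENNReal.tsum_geometric]
    exact ENNReal.inv_ne_top.2 (tsub_pos_of_lt hlt).ne'
  · refine le_trans (ite_le_sup _ _ _) (sup_le (le_of_eq ?_) zero_le)
    rw [zero_sub, ENNReal.zpow_neg, zpow_natCast, ENNReal.inv_pow, ← ENNReal.rpow_natCast,
      ← ENNReal.rpow_natCast, ← ENNReal.rpow_mul, ← ENNReal.rpow_mul, mul_comm]

/-- For finite nonzero `m x` the single level `j` with `2 ^ j < m x ≤ 2 ^ (j + 1)` suffices; the
lost factor is `2 ^ q x ≤ 2 ^ P`. If `m x = ∞`, every level occurs and the terms are unbounded. -/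
theorem rpow_le_tsum_indicator (hq : BddExponent q P) {m : (Fin n → ℝ) → ℝ≥0∞}
    {W : ℤ → Set (Fin n → ℝ)} (hW : ∀ k x, (2 : ℝ≥0∞) ^ k < m x → x ∈ W k) (x : Fin n → ℝ) :
    m x ^ q x ≤ ∑' k : ℤ, (W k).indicator (fun x => 2 ^ P * ((2 : ℝ≥0∞) ^ k) ^ q x) x := by
  have hq0 : 0 < q x := zero_lt_one.trans_le (hq.one_le x)
  rcases eq_or_ne (m x) 0 with h0 | h0
  · rw [h0, ENNReal.zero_rpow_of_pos hq0]
    exact zero_le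
  rcases eq_or_ne (m x) ∞ with h1 | h1
  · refine le_of_le_of_eq le_top (ENNReal.eq_top_of_forall_nnreal_le fun r => ?_).symm
    obtain ⟨k, hk⟩ := pow_unbounded_of_one_lt r (by norm_num : (1 : ℝ≥0) < 2)
    refine le_trans ?_ (ENNReal.le_tsum (k : ℤ))
    have hmem : x ∈ W k := hW k x (by
      rw [h1, zpow_natCast]
      exact (ENNReal.pow_ne_top (by norm_num)).lt_top)
    rw [indicator_of_mem hmem, zpow_natCast]
    have h2 : (1 : ℝ≥0∞) ≤ 2 ^ P :=
      ENNReal.one_le_rpow (by norm_num) (zero_lt_one.trans_le hq.one_le_bound)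
    have h3 : (2 : ℝ≥0∞) ^ k ≤ ((2 : ℝ≥0∞) ^ k) ^ q x := by
      simpa using ENNReal.rpow_le_rpow_of_exponent_le
        (one_le_pow₀ (by norm_num : (1 : ℝ≥0∞) ≤ 2) (n := k)) (hq.one_le x)
    calc (r : ℝ≥0∞) ≤ 2 ^ k := by exact_mod_cast hk.le
      _ ≤ 1 * ((2 : ℝ≥0∞) ^ k) ^ q x := by rwa [one_mul]
      _ ≤ _ := by gcongr
  · obtain ⟨j, hj1, hj2⟩ :=
      ENNReal.exists_mem_Ioc_zpow h0 h1 (y := 2) (by norm_num) (by norm_num)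
    refine le_trans ?_ (ENNReal.le_tsum j)
    rw [indicator_of_mem (hW j x hj1)]
    calc m x ^ q x ≤ (2 ^ (j + 1)) ^ q x := by gcongr
      _ = 2 ^ q x * (2 ^ j) ^ q x := by
        rw [ENNReal.zpow_add two_ne_zero (by norm_num), zpow_one, mul_comm,
          ENNReal.mul_rpow_of_nonneg _ _ hq0.le]
      _ ≤ _ := by
        gcongr
        · norm_num
        · exact hq.le x

theorem BddExponent.wt_lt_le (hq : BddExponent q P) (s : ℝ≥0) {g : (Fin n → ℝ) → ℝ≥0∞}
    (hg : Measurable g) : wt q s {x | (s : ℝ≥0∞) < g x} ≤ ∫⁻ x, g x ^ q x :=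
  (setLIntegral_mono' (measurableSet_lt measurable_const hg) fun x (hx : (s : ℝ≥0∞) < g x) =>
    ENNReal.rpow_le_rpow hx.le (hq.nonneg x)).trans (setLIntegral_le_lintegral _ _)

/-- Vitali covering at one level. -/
theorem exists_level_cover (hq : BddExponent q P) (hn : 0 < n) {s : ℝ≥0} (hs : 0 < s)
    {η D : ℝ≥0} (hη : η * 5 ^ n ≤ 1 / 2) {Ω S V : Set (Fin n → ℝ)} (hS : MeasurableSet S)
    (hS1 : wt q s S ≤ 1)
    (hΩ : ∀ x ∈ Ω, ∃ Q : AxisCube n, x ∈ Q.toSet ∧ Occupies (1 / 2) Q (Q.toSet ∩ S))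
    (hD : ∀ (Q : AxisCube n) (F : Set (Fin n → ℝ)), MeasurableSet F → F ⊆ Q.toSet → F ⊆ S →
      Occupies η Q F → wt q s (Q.toSet \ V) ≤ D * wt q s F) :
    ∃ W, MeasurableSet W ∧ Ω ⊆ W ∧ wt q s W ≤ D * wt q s S + wt q s V := by
  set T : Set (AxisCube n) := {Q | Occupies (1 / 2) Q (Q.toSet ∩ S)} with hT
  obtain ⟨b, hb⟩ : ∃ b : ℝ≥0, (b : ℝ≥0∞) = 2 / ((min 1 s : ℝ≥0) : ℝ≥0∞) ^ P :=
    ⟨_, ENNReal.coe_toNNReal (ENNReal.div_ne_top (by norm_num) (min_rpow_ne_zero hs P))⟩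
  -- Half of `Q` lies in `S`, whose modular is at most `1`, so `|Q| ≤ 2 / min(1, s) ^ P`.
  have hside : ∀ Q ∈ T, Q.side ≤ max 1 b := fun Q hQ => by
    refine AxisCube.side_le_of_volume_le hn ?_
    have h1 : ((1 / 2 : ℝ≥0) : ℝ≥0∞) * volume Q.toSet ≤ volume (Q.toSet ∩ S) := hQ
    have h2 : ((min 1 s : ℝ≥0) : ℝ≥0∞) ^ P * volume (Q.toSet ∩ S) ≤ 1 :=
      ((hq.volume_le_wt s _).trans (wt_mono_set s inter_subset_right)).trans hS1
    rw [hb, ENNReal.le_div_iff_mul_le (Or.inl (min_rpow_ne_zero hs P)) (Or.inr (by norm_num))]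
    have h3 : (2 : ℝ≥0∞) * ((1 / 2 : ℝ≥0) : ℝ≥0∞) = 1 := by
      rw [← ENNReal.coe_ofNat, ← ENNReal.coe_mul, ← ENNReal.coe_one]
      norm_num
    calc volume Q.toSet * ((min 1 s : ℝ≥0) : ℝ≥0∞) ^ P
        = 2 * (((min 1 s : ℝ≥0) : ℝ≥0∞) ^ P * (((1 / 2 : ℝ≥0) : ℝ≥0∞) * volume Q.toSet)) := by
          rw [mul_left_comm, ← mul_assoc 2, h3, one_mul, mul_comm]
      _ ≤ 2 * (((min 1 s : ℝ≥0) : ℝ≥0∞) ^ P * volume (Q.toSet ∩ S)) := by gcongr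
      _ ≤ 2 * 1 := by gcongr
      _ = 2 := mul_one 2
  obtain ⟨U, hUT, hd, hc⟩ := AxisCube.exists_vitali T _ hside
  have hcount : Countable U := (AxisCube.countable_of_pairwiseDisjoint hd).to_subtype
  have hd' : Pairwise (Function.onFun Disjoint fun R : U => (R : AxisCube n).toSet) :=
    fun R T hRT => hd R.2 T.2 fun h => hRT (Subtype.ext h)
  refine ⟨⋃ R : U, (R : AxisCube n).dilate.toSet,
    MeasurableSet.iUnion fun R => AxisCube.measurableSet_toSet _, fun x hx => ?_, ?_⟩
  · obtain ⟨Q, hxQ, hQ⟩ := hΩ x hx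
    obtain ⟨R, hR, hQR⟩ := hc Q hQ
    exact mem_iUnion.2 ⟨⟨R, hR⟩, hQR hxQ⟩
  have hpart (R : U) : wt q s ((R : AxisCube n).dilate.toSet \ V) ≤
      D * wt q s ((R : AxisCube n).toSet ∩ S) := by
    refine hD _ _ ((AxisCube.measurableSet_toSet _).inter hS)
      (inter_subset_left.trans (AxisCube.subset_dilate _)) inter_subset_right ?_
    refine le_trans ?_ (hUT R.2 : Occupies (1 / 2) (R : AxisCube n) _)
    rw [AxisCube.volume_dilate, ← mul_assoc]
    gcongr
    exact_mod_cast hη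
  calc wt q s (⋃ R : U, (R : AxisCube n).dilate.toSet)
      ≤ wt q s (⋃ R : U, (R : AxisCube n).dilate.toSet \ V) + wt q s V := by
        refine le_trans (wt_mono_set s ?_) (wt_union_le s _ _)
        rw [← iUnion_sdiff, sdiff_union_self]
        exact subset_union_left
    _ ≤ ∑' R : U, D * wt q s ((R : AxisCube n).toSet ∩ S) + wt q s V := by
        gcongr
        exact (wt_iUnion_le _ _).trans (ENNReal.tsum_le_tsum hpart)
    _ ≤ D * wt q s S + wt q s V := by
        rw [ENNReal.tsum_mul_left]
        gcongr
        exact tsum_wt_le s (fun R => (AxisCube.measurableSet_toSet _).inter hS)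
          (fun R T hRT => (hd' hRT).mono inter_subset_left inter_subset_left)
          fun R => inter_subset_right

/-- Modular estimate at a single level, with a summable error for small levels. -/
theorem exists_level_estimate (hq : BddExponent q P) (hn : 0 < n)
    (h : ∀ η : ℝ≥0, 0 < η → ∃ K, ModDom q (Occupies η) K) :
    ∃ c D M : ℝ≥0, ∃ δ : ℝ, 0 < c ∧ c ≤ 1 ∧ 0 < δ ∧ ∀ (s : ℝ≥0) (Ω S : Set (Fin n → ℝ)), 0 < s →
      MeasurableSet S → wt q s S ≤ c →
      (∀ x ∈ Ω, ∃ Q : AxisCube n, x ∈ Q.toSet ∧ Occupies (1 / 2) Q (Q.toSet ∩ S)) →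
      ∃ W, MeasurableSet W ∧ Ω ⊆ W ∧
        wt q s W ≤ D * wt q s S + if s < 1 then M * (s : ℝ≥0∞) ^ δ else 0 := by
  -- Half of a cube is exactly the proportion `η` of its dilate.
  set η : ℝ≥0 := 1 / 2 / 5 ^ n with hη
  have hη0 : 0 < η := by positivity
  have hη5 : η * 5 ^ n = 1 / 2 := by rw [hη, div_mul_cancel₀ _ (by positivity)]
  have hηhalf : η ≤ 1 / 2 := div_le_self zero_le (one_le_pow₀ (by norm_num))
  have hη1 : η ≤ 1 := hηhalf.trans (by norm_num)
  obtain ⟨K, hK⟩ := h (η / 2) (half_pos hη0)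
  set A : ℝ≥0 := (K + 1) * (2 / η) with hA
  have hA1 : 1 ≤ A := by
    refine one_le_mul (le_add_of_nonneg_left zero_le) ?_
    rw [le_div_iff₀ hη0, one_mul]
    exact hη1.trans (by norm_num)
  obtain ⟨ε, hε, D, hD⟩ := exists_wt_diff_le n hA1 hηhalf hη0
  have h1ε : 0 < 1 + ε := by linarith
  -- The threshold `η / 2` is the smallness required by `ModDom.wt_le_of_one_le`; `A` serves the
  -- levels `s ≥ 1` and `D` the levels `s < 1`.
  refine ⟨η / 2, max A D, A * K, ε / (1 + ε), half_pos hη0, (half_le_self zero_le).trans hη1,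
    by positivity, ?_⟩
  intro s Ω S hs hS hSc hΩ
  have hS1 : wt q s S ≤ 1 :=
    hSc.trans (by exact_mod_cast (half_le_self zero_le).trans hη1)
  by_cases hs1 : s < 1
  -- Level `s` is the improved level of `σ`, so bad cubes are taken at level `σ`. Writing `s = σ ^ ε
  -- * σ` and using `q ≥ 1`, the modular of `V` at level `s` gains `σ ^ ε = s ^ (ε / (1 + ε))`.
  · set σ : ℝ≥0 := s ^ (1 / (1 + ε)) with hσ
    have hσ0 : 0 < σ := NNReal.rpow_pos hs
    have hσ1 : σ ≤ 1 := NNReal.rpow_le_one hs1.le (by positivity)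
    have hσs : σ ^ (1 + ε) = s := by
      rw [hσ, ← NNReal.rpow_mul, one_div, inv_mul_cancel₀ h1ε.ne', NNReal.rpow_one]
    have hsσ : σ ^ ε * σ = s := by
      rw [← hσs, add_comm, NNReal.rpow_add hσ0.ne', NNReal.rpow_one]
    obtain ⟨V, hV, hbad, hVw⟩ := exists_bad_cover hq hn hη0
      (hη5.le.trans (by norm_num)) hK le_rfl hσ0 hσ1
    obtain ⟨W, hW, hΩW, hle⟩ := exists_level_cover hq hn hs (D := D) (V := V) hη5.le hS hS1 hΩ
      (fun Q F hF hFQ _ ho => by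
        have := hD q P hq σ hσ0 hσ1 V hbad Q F hF hFQ ho
        rwa [hσs] at this)
    refine ⟨W, hW, hΩW, hle.trans ?_⟩
    rw [if_pos hs1]
    have hVs : wt q s V ≤ (A * K : ℝ≥0) * (s : ℝ≥0∞) ^ (ε / (1 + ε)) := by
      have h1 := hq.wt_mul_le_mul (r := σ ^ ε) (s := σ) (NNReal.rpow_le_one hσ1 hε.le) V
      rw [hsσ] at h1
      have h2 : ((σ ^ ε : ℝ≥0) : ℝ≥0∞) = (s : ℝ≥0∞) ^ (ε / (1 + ε)) := by
        rw [← ENNReal.coe_rpow_of_ne_zero hs.ne', hσ, ← NNReal.rpow_mul]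
        congr 2
        field_simp
      rw [h2, mul_comm] at h1
      exact h1.trans (by gcongr)
    gcongr
    exact le_max_right _ _
  · have hs1' : 1 ≤ s := not_lt.1 hs1
    obtain ⟨W, hW, hΩW, hle⟩ := exists_level_cover hq hn hs (D := A) (V := ∅) hη5.le hS hS1 hΩ
      (fun Q F hF hFQ hFS ho => by
        rw [sdiff_empty]
        exact hK.wt_le_of_one_le hq hη0 hη1 hs1' hF hFQ ho ((wt_mono_set s hFS).trans hSc))
    refine ⟨W, hW, hΩW, hle.trans ?_⟩
    rw [if_neg hs1]
    have : wt q s (∅ : Set (Fin n → ℝ)) = 0 := by simp [wt]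
    rw [this]
    gcongr
    exact le_max_left _ _

/-- Modular form of the boundedness of the median maximal operator. -/
theorem exists_modular_estimate (hq : BddExponent q P) (hn : 0 < n)
    (h : ∀ η : ℝ≥0, 0 < η → ∃ K, ModDom q (Occupies η) K) :
    ∃ c C : ℝ≥0, 0 < c ∧ c ≤ 1 ∧ ∀ m g : (Fin n → ℝ) → ℝ≥0∞, Measurable g →
      ∫⁻ x, g x ^ q x ≤ c →
      (∀ (s : ℝ≥0) (x : Fin n → ℝ), 0 < s → (s : ℝ≥0∞) < m x → ∃ Q : AxisCube n, x ∈ Q.toSet ∧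
        Occupies (1 / 2) Q (Q.toSet ∩ {y | (s : ℝ≥0∞) < g y})) →
      ∫⁻ x, m x ^ q x ≤ C := by
  obtain ⟨c, D, M, δ, hc0, hc1, hδ, hest⟩ := exists_level_estimate hq hn h
  set Z : ℝ≥0∞ := ∑' k : ℤ, (if k < 0 then ((2 : ℝ≥0∞) ^ k) ^ δ else 0) with hZ
  have hZtop : Z ≠ ∞ := tsum_two_zpow_rpow_ne_top hδ
  have hP0 : 0 ≤ P := zero_le_one.trans hq.one_le_bound
  have h2P : (2 : ℝ≥0∞) ^ P ≠ ∞ := ENNReal.rpow_ne_top_of_nonneg hP0 (by norm_num)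
  obtain ⟨C, hC⟩ : ∃ C : ℝ≥0, (C : ℝ≥0∞) = 2 ^ P * (D * (2 * c) + M * Z) :=
    ⟨_, ENNReal.coe_toNNReal (ENNReal.mul_ne_top h2P (ENNReal.add_ne_top.2
      ⟨ENNReal.mul_ne_top ENNReal.coe_ne_top
        (ENNReal.mul_ne_top (by norm_num) ENNReal.coe_ne_top),
        ENNReal.mul_ne_top ENNReal.coe_ne_top hZtop⟩))⟩
  refine ⟨c, C, hc0, hc1, fun m g hg hgc hm => ?_⟩
  have hcoe (k : ℤ) : (((2 : ℝ≥0) ^ k : ℝ≥0) : ℝ≥0∞) = (2 : ℝ≥0∞) ^ k := by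
    rw [ENNReal.coe_zpow two_ne_zero, ENNReal.coe_ofNat]
  have hpos (k : ℤ) : 0 < (2 : ℝ≥0) ^ k := zpow_pos two_pos k
  have hSm (k : ℤ) : MeasurableSet {x | (((2 : ℝ≥0) ^ k : ℝ≥0) : ℝ≥0∞) < g x} :=
    measurableSet_lt measurable_const hg
  choose W hWm hW hWle using fun k : ℤ => hest ((2 : ℝ≥0) ^ k)
    {x | (((2 : ℝ≥0) ^ k : ℝ≥0) : ℝ≥0∞) < m x} {x | (((2 : ℝ≥0) ^ k : ℝ≥0) : ℝ≥0∞) < g x} (hpos k)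
    (hSm k) ((hq.wt_lt_le _ hg).trans hgc) (fun x hx => hm _ x (hpos k) hx)
  have hSsum : ∑' k : ℤ, wt q ((2 : ℝ≥0) ^ k) {x | (((2 : ℝ≥0) ^ k : ℝ≥0) : ℝ≥0∞) < g x} ≤
      2 * c := by
    calc ∑' k : ℤ, wt q ((2 : ℝ≥0) ^ k) {x | (((2 : ℝ≥0) ^ k : ℝ≥0) : ℝ≥0∞) < g x}
        = ∫⁻ x, ∑' k : ℤ, {x | (((2 : ℝ≥0) ^ k : ℝ≥0) : ℝ≥0∞) < g x}.indicator
            (fun x => (((2 : ℝ≥0) ^ k : ℝ≥0) : ℝ≥0∞) ^ q x) x := by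
          rw [lintegral_tsum fun k => ((hq.measurable_rpow _).indicator (hSm k)).aemeasurable]
          exact tsum_congr fun k => (lintegral_indicator (hSm k) _).symm
      _ ≤ ∫⁻ x, 2 * g x ^ q x := by
          refine lintegral_mono fun x => ?_
          refine le_trans (le_of_eq (tsum_congr fun k => ?_))
            (tsum_two_zpow_indicator_le (hq.one_le x) (g x))
          simp only [indicator, hcoe]
          rfl
      _ = 2 * ∫⁻ x, g x ^ q x := lintegral_const_mul _ (hg.pow hq.measurable)
      _ ≤ 2 * c := by gcongr
  calc ∫⁻ x, m x ^ q x
      ≤ ∫⁻ x, ∑' k : ℤ, (W k).indicator (fun x => 2 ^ P * ((2 : ℝ≥0∞) ^ k) ^ q x) x :=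
        lintegral_mono fun x => rpow_le_tsum_indicator hq
          (fun k y hy => hW k (by rw [← hcoe k] at hy; exact hy)) x
    _ = ∑' k : ℤ, 2 ^ P * wt q ((2 : ℝ≥0) ^ k) (W k) := by
        rw [lintegral_tsum fun k =>
          (((hq.measurable_rpow _).const_mul _).indicator (hWm k)).aemeasurable]
        refine tsum_congr fun k => ?_
        rw [lintegral_indicator (hWm k), lintegral_const_mul _ (hq.measurable_rpow _), wt, hcoe]
    _ ≤ 2 ^ P * ∑' k : ℤ, (D * wt q ((2 : ℝ≥0) ^ k)
          {x | (((2 : ℝ≥0) ^ k : ℝ≥0) : ℝ≥0∞) < g x} +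
          M * (if k < 0 then ((2 : ℝ≥0∞) ^ k) ^ δ else 0)) := by
        rw [ENNReal.tsum_mul_left]
        gcongr with k
        refine (hWle k).trans (le_of_eq ?_)
        congr 1
        by_cases hk : k < 0
        · rw [if_pos hk, if_pos (zpow_lt_one_of_neg₀ one_lt_two hk), hcoe]
        · rw [if_neg hk, if_neg (not_lt.2 (one_le_zpow₀ one_le_two (not_lt.1 hk))), mul_zero]
    _ = 2 ^ P * (D * ∑' k : ℤ, wt q ((2 : ℝ≥0) ^ k)
          {x | (((2 : ℝ≥0) ^ k : ℝ≥0) : ℝ≥0∞) < g x} + M * Z) := by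
        rw [ENNReal.tsum_add, ENNReal.tsum_mul_left, ENNReal.tsum_mul_left]
    _ ≤ 2 ^ P * (D * (2 * c) + M * Z) := by gcongr
    _ = C := hC.symm

end Core

/-! ### Luxemburg norm and modular -/

section Norm

variable {n : ℕ} {p : (Fin n → ℝ) → ℝ≥0∞} {q : (Fin n → ℝ) → ℝ} {P : ℝ}

/-- A bounded exponent agrees almost everywhere with a measurable real-valued one. -/
theorem exists_bddExponent (hp : AEMeasurable p volume) (hp_minus : 1 ≤ essInf p volume)
    (hp_plus : essSup p volume < ∞) :
    ∃ (q : (Fin n → ℝ) → ℝ) (P : ℝ), BddExponent q P ∧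
      ∀ᵐ x, ∀ s, expPow s (p x) = s ^ q x := by
  set P : ℝ := max 1 (essSup p volume).toReal with hP
  -- Truncation makes the bounds hold everywhere and changes the exponent only on a null set.
  refine ⟨fun x => max 1 (min P (hp.mk p x).toReal), P, ⟨?_, fun x => le_max_left _ _,
    fun x => max_le (le_max_left _ _) (min_le_left _ _)⟩, ?_⟩
  · exact measurable_const.max (measurable_const.min hp.measurable_mk.ennreal_toReal)
  · filter_upwards [hp.ae_eq_mk, ae_le_essSup (μ := volume) (f := p),
      ae_essInf_le (μ := volume) (f := p)]
      with x h1 h2 h3 s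
    have htop : p x ≠ ∞ := (h2.trans_lt hp_plus).ne
    have h4 : 1 ≤ (p x).toReal := by
      rw [← ENNReal.toReal_one]
      exact ENNReal.toReal_mono htop (hp_minus.trans h3)
    have h5 : (p x).toReal ≤ P :=
      (ENNReal.toReal_mono hp_plus.ne h2).trans (le_max_right _ _)
    rw [expPow, if_neg htop, ← h1, min_eq_right h5, max_eq_right h4]

theorem modular_eq (hpq : ∀ᵐ x, ∀ s, expPow s (p x) = s ^ q x) (g : (Fin n → ℝ) → ℝ≥0∞) :
    modular p g = ∫⁻ x, g x ^ q x :=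
  lintegral_congr_ae (hpq.mono fun x hx => hx (g x))

theorem expPow_mono {a b : ℝ≥0∞} (h : a ≤ b) (r : ℝ≥0∞) : expPow a r ≤ expPow b r := by
  unfold expPow
  split_ifs with h1 h2 h3 h3
  · exact le_rfl
  · exact zero_le
  · exact absurd (h.trans h3) h2
  · exact le_rfl
  · exact ENNReal.rpow_le_rpow h ENNReal.toReal_nonneg

theorem modular_mono {f g : (Fin n → ℝ) → ℝ≥0∞} (h : ∀ x, f x ≤ g x) :
    modular p f ≤ modular p g :=
  lintegral_mono fun x => expPow_mono (h x) _

theorem luxNorm_mono {f g : (Fin n → ℝ) → ℝ≥0∞} (h : ∀ x, f x ≤ g x) :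
    luxNorm p f ≤ luxNorm p g := by
  refine le_iInf fun l => le_iInf fun hl => le_iInf fun hm => ?_
  exact iInf_le_of_le l (iInf_le_of_le hl (iInf_le_of_le
    ((modular_mono fun x => ENNReal.div_le_div_right (h x) _).trans hm) le_rfl))

theorem luxNorm_le {g : (Fin n → ℝ) → ℝ≥0∞} {l : ℝ≥0} (hl : 0 < l)
    (h : modular p (fun x => g x / l) ≤ 1) : luxNorm p g ≤ l :=
  iInf_le_of_le l (iInf_le_of_le hl (iInf_le_of_le h le_rfl))

theorem modular_le_one_of_luxNorm_lt {g : (Fin n → ℝ) → ℝ≥0∞} {l : ℝ≥0}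
    (h : luxNorm p g < l) : modular p (fun x => g x / l) ≤ 1 := by
  simp only [luxNorm, iInf_lt_iff] at h
  obtain ⟨k, -, hk, hlt⟩ := h
  exact (modular_mono fun x => ENNReal.div_le_div_left hlt.le _).trans hk

/-- Since `q ≥ 1`, dividing the function by `C ≥ 1` divides its modular by at least `C`. -/
theorem luxNorm_le_mul (hq : BddExponent q P) (hpq : ∀ᵐ x, ∀ s, expPow s (p x) = s ^ q x)
    {g : (Fin n → ℝ) → ℝ≥0∞} {l C : ℝ≥0} (hl : 0 < l) (hC : 1 ≤ C)
    (h : ∫⁻ x, (g x / l) ^ q x ≤ C) : luxNorm p g ≤ (C * l : ℝ≥0) := by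
  have hC0 : 0 < C := zero_lt_one.trans_le hC
  refine luxNorm_le (mul_pos hC0 hl) ?_
  rw [modular_eq hpq]
  calc ∫⁻ x, (g x / (C * l : ℝ≥0)) ^ q x
      ≤ ∫⁻ x, ((C⁻¹ : ℝ≥0) : ℝ≥0∞) * (g x / l) ^ q x := by
        refine lintegral_mono fun x => ?_
        have h1 : g x / (C * l : ℝ≥0) = ((C⁻¹ : ℝ≥0) : ℝ≥0∞) * (g x / l) := by
          rw [div_eq_mul_inv, div_eq_mul_inv, ← ENNReal.coe_inv (mul_pos hC0 hl).ne',
            ← ENNReal.coe_inv hl.ne', mul_inv, ENNReal.coe_mul]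
          ring
        simp only [h1]
        rw [ENNReal.mul_rpow_of_nonneg _ _ (hq.nonneg x)]
        gcongr
        have h2 : ((C⁻¹ : ℝ≥0) : ℝ≥0∞) ≤ 1 := by exact_mod_cast inv_le_one_of_one_le₀ hC
        simpa using ENNReal.rpow_le_rpow_of_exponent_ge h2 (hq.one_le x)
    _ = ((C⁻¹ : ℝ≥0) : ℝ≥0∞) * ∫⁻ x, (g x / l) ^ q x :=
        lintegral_const_mul' _ _ ENNReal.coe_ne_top
    _ ≤ ((C⁻¹ : ℝ≥0) : ℝ≥0∞) * C := by gcongr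
    _ = 1 := by rw [← ENNReal.coe_mul, inv_mul_cancel₀ hC0.ne', ENNReal.coe_one]

theorem lintegral_rpow_le_of_luxNorm_lt (hq : BddExponent q P)
    (hpq : ∀ᵐ x, ∀ s, expPow s (p x) = s ^ q x) {g : (Fin n → ℝ) → ℝ≥0∞} {l : ℝ≥0}
    (hl : 1 ≤ l) (h : luxNorm p g < l) : ∫⁻ x, g x ^ q x ≤ (l ^ P : ℝ≥0) := by
  have hl0 : l ≠ 0 := (zero_lt_one.trans_le hl).ne'
  have h1 := modular_le_one_of_luxNorm_lt h
  rw [modular_eq hpq] at h1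
  calc ∫⁻ x, g x ^ q x ≤ ∫⁻ x, ((l ^ P : ℝ≥0) : ℝ≥0∞) * (g x / l) ^ q x := by
        refine lintegral_mono fun x => ?_
        have h2 : g x = l * (g x / l) :=
          (ENNReal.mul_div_cancel (by exact_mod_cast hl0) ENNReal.coe_ne_top).symm
        calc g x ^ q x = (l : ℝ≥0∞) ^ q x * (g x / l) ^ q x := by
              conv_lhs => rw [h2]
              exact ENNReal.mul_rpow_of_nonneg _ _ (hq.nonneg x)
          _ ≤ _ := by
              gcongr
              rw [ENNReal.coe_rpow_of_ne_zero hl0]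
              exact ENNReal.rpow_le_rpow_of_exponent_le (by exact_mod_cast hl) (hq.le x)
    _ = ((l ^ P : ℝ≥0) : ℝ≥0∞) * ∫⁻ x, (g x / l) ^ q x :=
        lintegral_const_mul' _ _ ENNReal.coe_ne_top
    _ ≤ ((l ^ P : ℝ≥0) : ℝ≥0∞) * 1 := by gcongr
    _ = _ := mul_one _

/-! ### Step functions on disjoint sets -/

theorem tsum_indicator_of_mem {ι : Type*} {E : ι → Set (Fin n → ℝ)} {c : ι → ℝ≥0∞}
    (hd : Pairwise (Function.onFun Disjoint E)) {i : ι} {x : Fin n → ℝ} (hx : x ∈ E i) :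
    ∑' k, (E k).indicator (fun _ => c k) x = c i := by
  rw [tsum_eq_single i fun k hk => indicator_of_notMem
    (fun hxk => Set.disjoint_left.1 (hd hk) hxk hx) _, indicator_of_mem hx]

theorem tsum_indicator_of_forall_notMem {ι : Type*} {E : ι → Set (Fin n → ℝ)} {c : ι → ℝ≥0∞}
    {x : Fin n → ℝ} (hx : ∀ i, x ∉ E i) : ∑' k, (E k).indicator (fun _ => c k) x = 0 :=
  ENNReal.tsum_eq_zero.2 fun i => indicator_of_notMem (hx i) _

theorem lintegral_tsum_indicator_rpow (hq : BddExponent q P) {ι : Type*} [Countable ι]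
    {E : ι → Set (Fin n → ℝ)} (c : ι → ℝ≥0) (hE : ∀ i, MeasurableSet (E i))
    (hd : Pairwise (Function.onFun Disjoint E)) :
    ∫⁻ x, (∑' i, (E i).indicator (fun _ => (c i : ℝ≥0∞)) x) ^ q x = ∑' i, wt q (c i) (E i) := by
  have h1 (x : Fin n → ℝ) : (∑' i, (E i).indicator (fun _ => (c i : ℝ≥0∞)) x) ^ q x =
      ∑' i, (E i).indicator (fun x => (c i : ℝ≥0∞) ^ q x) x := by
    by_cases hx : ∃ i, x ∈ E i
    · obtain ⟨i, hi⟩ := hx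
      rw [tsum_indicator_of_mem hd hi, tsum_eq_single i fun k hk => indicator_of_notMem
        (fun hxk => Set.disjoint_left.1 (hd hk) hxk hi) _, indicator_of_mem hi]
    · push Not at hx
      rw [tsum_indicator_of_forall_notMem hx,
        ENNReal.zero_rpow_of_pos (zero_lt_one.trans_le (hq.one_le x))]
      exact (ENNReal.tsum_eq_zero.2 fun i => indicator_of_notMem (hx i) _).symm
  simp only [h1]
  rw [lintegral_tsum fun i => ((hq.measurable_rpow _).indicator (hE i)).aemeasurable]
  exact tsum_congr fun i => lintegral_indicator (hE i) _

/-- The condition `𝒜_∞` in modular form. -/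
theorem AInfty.exists_modDom (hq : BddExponent q P)
    (hpq : ∀ᵐ x, ∀ s, expPow s (p x) = s ^ q x) (h : AInfty p) :
    ∃ lam K : ℝ≥0, 0 < lam ∧ lam < 1 ∧ ModDom q (Occupies lam) K := by
  obtain ⟨lam, ⟨hl0, hl1⟩, C, hC, hA⟩ := h
  refine ⟨lam.toNNReal, (C + 1) ^ P, Real.toNNReal_pos.2 hl0, Real.toNNReal_lt_one.2 hl1, ?_⟩
  intro ι _ Q c E hd hE hs
  have hinj : Function.Injective Q := fun i k hik => by
    by_contra hne
    have := hd hne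
    simp only [Function.onFun, hik, disjoint_self, bot_eq_empty] at this
    exact (Q k).nonempty_toSet.ne_empty this
  have hdE : Pairwise (Function.onFun Disjoint E) := fun i k hik =>
    (hd hik).mono (hE i).2.1 (hE k).2.1
  have key := hA (range Q) ?_ (Function.extend Q c 0) (Function.extend Q E fun _ => ∅) ?_
  · have e1 : stepSum (range Q) (Function.extend Q c 0) AxisCube.toSet =
        fun x => ∑' i, (Q i).toSet.indicator (fun _ => (c i : ℝ≥0∞)) x := by
      funext x
      rw [stepSum, tsum_range (fun R => (AxisCube.toSet R).indicator
        (fun _ => ((Function.extend Q c 0 R : ℝ≥0) : ℝ≥0∞)) x) hinj]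
      simp only [hinj.extend_apply]
    have e2 : stepSum (range Q) (Function.extend Q c 0) (Function.extend Q E fun _ => ∅) =
        fun x => ∑' i, (E i).indicator (fun _ => (c i : ℝ≥0∞)) x := by
      funext x
      rw [stepSum, tsum_range (fun R => (Function.extend Q E (fun _ => ∅) R).indicator
        (fun _ => ((Function.extend Q c 0 R : ℝ≥0) : ℝ≥0∞)) x) hinj]
      simp only [hinj.extend_apply]
    rw [e1, e2] at key
    have hle1 : luxNorm p (fun x => ∑' i, (E i).indicator (fun _ => (c i : ℝ≥0∞)) x) ≤
        (1 : ℝ≥0) := by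
      refine luxNorm_le one_pos ?_
      rw [modular_eq hpq]
      simp only [ENNReal.coe_one, div_one]
      rwa [lintegral_tsum_indicator_rpow hq c (fun i => (hE i).1) hdE]
    -- The modular is controlled at any number strictly above the norm, hence `C + 1` in place of
    -- `C`.
    have hlt : luxNorm p (fun x => ∑' i, (Q i).toSet.indicator (fun _ => (c i : ℝ≥0∞)) x) <
        (C + 1 : ℝ≥0) := by
      refine lt_of_le_of_lt (key.trans (mul_le_mul' le_rfl hle1)) ?_
      rw [ENNReal.coe_one, mul_one]
      exact_mod_cast lt_add_one C
    have := lintegral_rpow_le_of_luxNorm_lt hq hpq (le_add_of_nonneg_left zero_le) hlt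
    rwa [lintegral_tsum_indicator_rpow hq c (fun i => (Q i).measurableSet_toSet) hd] at this
  · rintro _ ⟨i, rfl⟩ _ ⟨k, rfl⟩ hne
    exact hd fun h => hne (congrArg Q h)
  · rintro _ ⟨i, rfl⟩
    rw [hinj.extend_apply]
    exact ⟨(hE i).1.nullMeasurableSet, (hE i).2.1, (hE i).2.2⟩

end Norm

/-! ### The equivalence -/

section Equivalence

variable {n : ℕ} {p : (Fin n → ℝ) → ℝ≥0∞} {q : (Fin n → ℝ) → ℝ} {P : ℝ}

theorem exists_cube_of_lt_medianMaximal {t : ℝ} {f : (Fin n → ℝ) → ℝ} {x : Fin n → ℝ} {a : ℝ≥0}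
    (ha : 0 < a) (h : (a : ℝ≥0∞) < medianMaximal t f x) :
    ∃ Q : AxisCube n, x ∈ Q.toSet ∧
      ENNReal.ofReal t * volume Q.toSet < volume (Q.toSet ∩ {y | (a : ℝ) < |f y|}) := by
  simp only [medianMaximal, lt_iSup_iff] at h
  obtain ⟨Q, hxQ, hlt⟩ := h
  refine ⟨Q, hxQ, ?_⟩
  by_contra hcon
  refine absurd hlt (not_lt.2 (iInf_le_of_le a (iInf_le_of_le ha (iInf_le_of_le ?_ le_rfl))))
  refine (measure_mono fun y hy => ?_).trans (not_lt.1 hcon)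
  have hy' : (a : ℝ) < |Q.toSet.indicator f y| := hy
  by_cases hyQ : y ∈ Q.toSet
  · rw [indicator_of_mem hyQ] at hy'
    exact ⟨hyQ, hy'⟩
  · rw [indicator_of_notMem hyQ, abs_zero] at hy'
    exact absurd hy' (not_lt.2 a.coe_nonneg)

theorem AInfty.medianMaximalBounded (hn : 0 < n) (hq : BddExponent q P)
    (hpq : ∀ᵐ x, ∀ s, expPow s (p x) = s ^ q x) (h : AInfty p) :
    MedianMaximalBounded (1 / 2) p := by
  obtain ⟨lam, K, hlam0, hlam1, hK⟩ := h.exists_modDom hq hpq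
  obtain ⟨c, C, hc0, hc1, hest⟩ := exists_modular_estimate hq hn
    fun η hη => hK.exists_forall hq hlam1 hlam0 hη
  refine ⟨max 1 C / c, fun f hf => ?_⟩
  have key (l : ℝ≥0) (hl : luxNorm p (fun x => ‖f x‖ₑ) < l) :
      luxNorm p (medianMaximal (1 / 2) f) ≤ (max 1 C / c * l : ℝ≥0) := by
    have hl0 : 0 < l := by
      have : (0 : ℝ≥0∞) < l := lt_of_le_of_lt zero_le hl
      exact_mod_cast this
    -- Dividing by `l / c` instead of `l` brings the modular of `f` below the threshold `c`, because
    -- `c ≤ 1 ≤ q`.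
    have hL0 : 0 < l / c := div_pos hl0 hc0
    have hL0' : ((l / c : ℝ≥0) : ℝ≥0∞) ≠ 0 := by exact_mod_cast hL0.ne'
    have hmod := modular_le_one_of_luxNorm_lt hl
    rw [modular_eq hpq] at hmod
    set g := hf.1.mk f with hg
    have hgm : Measurable g := hf.1.measurable_mk
    have hbound := hest (fun x => medianMaximal (1 / 2) f x / (l / c : ℝ≥0))
      (fun x => ‖g x‖ₑ / (l / c : ℝ≥0)) (hgm.enorm.div_const _) ?_ ?_
    · have := luxNorm_le_mul hq hpq hL0 (le_max_left 1 C)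
        (hbound.trans (by exact_mod_cast le_max_right 1 C))
      refine this.trans (le_of_eq ?_)
      congr 1
      rw [mul_div_assoc', div_mul_eq_mul_div]
    · calc ∫⁻ x, (‖g x‖ₑ / (l / c : ℝ≥0)) ^ q x
          = ∫⁻ x, (‖f x‖ₑ / (l / c : ℝ≥0)) ^ q x :=
            lintegral_congr_ae (hf.1.ae_eq_mk.mono fun x hx => by simp only [hg, ← hx])
        _ ≤ ∫⁻ x, (c : ℝ≥0∞) * (‖f x‖ₑ / l) ^ q x := by
            refine lintegral_mono fun x => ?_
            have h1 : ‖f x‖ₑ / (l / c : ℝ≥0) = (c : ℝ≥0∞) * (‖f x‖ₑ / l) := by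
              rw [ENNReal.div_eq_inv_mul, ENNReal.div_eq_inv_mul, ← ENNReal.coe_inv hL0.ne',
                ← ENNReal.coe_inv hl0.ne', inv_div, div_eq_mul_inv, ENNReal.coe_mul, mul_assoc]
            simp only [h1]
            rw [ENNReal.mul_rpow_of_nonneg _ _ (hq.nonneg x)]
            gcongr
            have h2 : (c : ℝ≥0∞) ≤ 1 := by exact_mod_cast hc1
            simpa using ENNReal.rpow_le_rpow_of_exponent_ge h2 (hq.one_le x)
        _ = (c : ℝ≥0∞) * ∫⁻ x, (‖f x‖ₑ / l) ^ q x :=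
            lintegral_const_mul' _ _ ENNReal.coe_ne_top
        _ ≤ c * 1 := by gcongr
        _ = c := mul_one _
    · intro s x hs hlt
      rw [ENNReal.lt_div_iff_mul_lt (Or.inl hL0') (Or.inl ENNReal.coe_ne_top),
        ← ENNReal.coe_mul] at hlt
      obtain ⟨Q, hxQ, hQ⟩ := exists_cube_of_lt_medianMaximal (mul_pos hs hL0) hlt
      refine ⟨Q, hxQ, ?_⟩
      have hset : (Q.toSet ∩ {y | ((s * (l / c) : ℝ≥0) : ℝ) < |f y|} : Set (Fin n → ℝ)) =ᵐ[volume]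
          (Q.toSet ∩ {y | (s : ℝ≥0∞) < ‖g y‖ₑ / (l / c : ℝ≥0)} : Set (Fin n → ℝ)) := by
        refine (Filter.EventuallyEq.refl _ _).inter ?_
        filter_upwards [hf.1.ae_eq_mk] with y hy
        refine propext ?_
        show ((s * (l / c) : ℝ≥0) : ℝ) < |f y| ↔ (s : ℝ≥0∞) < ‖g y‖ₑ / (l / c : ℝ≥0)
        rw [ENNReal.lt_div_iff_mul_lt (Or.inl hL0') (Or.inl ENNReal.coe_ne_top),
          ← ENNReal.coe_mul, hg, ← hy, enorm_eq_nnnorm, ENNReal.coe_lt_coe, ← NNReal.coe_lt_coe,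
          coe_nnnorm, Real.norm_eq_abs]
      rw [Occupies, ← measure_congr hset]
      refine le_trans (le_of_eq ?_) hQ.le
      congr 1
      rw [← ENNReal.ofReal_coe_nnreal]
      norm_num
  -- The bound holds for every `l` above the norm of `f`; a number strictly in between would
  -- contradict it.
  by_contra hcon
  have hk0 : max 1 C / c ≠ 0 := (div_pos (zero_lt_one.trans_le (le_max_left _ _)) hc0).ne'
  have hk0' : ((max 1 C / c : ℝ≥0) : ℝ≥0∞) ≠ 0 := by exact_mod_cast hk0
  have hlt := not_le.1 hcon
  rw [mul_comm, ← ENNReal.lt_div_iff_mul_lt (Or.inl hk0') (Or.inl ENNReal.coe_ne_top)] at hlt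
  obtain ⟨l, hl1, hl2⟩ := ENNReal.lt_iff_exists_nnreal_btwn.1 hlt
  rw [ENNReal.lt_div_iff_mul_lt (Or.inl hk0') (Or.inl ENNReal.coe_ne_top), mul_comm,
    ← ENNReal.coe_mul] at hl2
  exact absurd (key l hl1) (not_le.2 hl2)

/-- On `Q` the maximal function of `∑ c_Q χ_{E_Q}` is at least `c_Q`: for `a < c_Q` the function
exceeds `a` on `E_Q`, which has measure at least `(1 + t)/2 · |Q| > t |Q|`. -/
theorem MedianMaximalBounded.aInfty {t : ℝ} (ht : t ∈ Ioo (0 : ℝ) 1)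
    (h : MedianMaximalBounded t p) : AInfty p := by
  obtain ⟨ht0, ht1⟩ := ht
  obtain ⟨C, hC⟩ := h
  refine ⟨(1 + t) / 2, ⟨by linarith, by linarith⟩, max C 1, lt_max_of_lt_right one_pos, ?_⟩
  intro F hF c E hE
  -- Boundedness speaks only of functions in the space. In the remaining case the right side is `∞`,
  -- because the constant `max C 1` is not zero.
  by_cases htop : luxNorm p (stepSum F c E) = ∞
  · rw [htop, ENNReal.mul_top]
    · exact le_top
    · exact_mod_cast (lt_max_of_lt_right one_pos : 0 < max C 1).ne'
  have hcount : Countable F := (AxisCube.countable_of_pairwiseDisjoint hF).to_subtype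
  have hdF : Pairwise (Function.onFun Disjoint fun Q : F => (Q : AxisCube n).toSet) :=
    fun Q R hQR => hF Q.2 R.2 fun h => hQR (Subtype.ext h)
  have hdE : Pairwise (Function.onFun Disjoint fun Q : F => E Q) := fun Q R hQR =>
    (hdF hQR).mono (hE Q Q.2).2.1 (hE R R.2).2.1
  have hmem (Q : F) (x : Fin n → ℝ) (hx : x ∈ E Q) : stepSum F c E x = c Q :=
    tsum_indicator_of_mem (c := fun Q : F => (c Q : ℝ≥0∞)) hdE hx
  have hfin (x : Fin n → ℝ) : stepSum F c E x ≠ ∞ := by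
    by_cases hx : ∃ Q : F, x ∈ E Q
    · obtain ⟨Q, hQ⟩ := hx
      rw [hmem Q x hQ]
      exact ENNReal.coe_ne_top
    · push Not at hx
      have : stepSum F c E x = 0 :=
        tsum_indicator_of_forall_notMem (c := fun Q : F => (c Q : ℝ≥0∞)) hx
      rw [this]
      exact ENNReal.zero_ne_top
  set f : (Fin n → ℝ) → ℝ := fun x => (stepSum F c E x).toReal with hf
  have hnorm : (fun x => ‖f x‖ₑ) = stepSum F c E := by
    funext x
    rw [hf, Real.enorm_of_nonneg ENNReal.toReal_nonneg, ENNReal.ofReal_toReal (hfin x)]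
  have hmeas : AEMeasurable f := by
    refine AEMeasurable.ennreal_toReal ?_
    exact AEMeasurable.tsum fun Q : F => aemeasurable_const.indicator₀ (hE Q Q.2).1
  have hbound := hC f ⟨hmeas, by rw [hnorm]; exact lt_top_iff_ne_top.2 htop⟩
  rw [hnorm] at hbound
  refine le_trans (luxNorm_mono fun x => ?_)
    (hbound.trans (mul_le_mul' (by exact_mod_cast le_max_left C 1) le_rfl))
  by_cases hx : ∃ Q : F, x ∈ (Q : AxisCube n).toSet
  · obtain ⟨Q, hQ⟩ := hx
    have hval : stepSum F c AxisCube.toSet x = c Q :=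
      tsum_indicator_of_mem (c := fun Q : F => (c Q : ℝ≥0∞)) hdF hQ
    rw [hval]
    refine le_iSup_of_le (Q : AxisCube n) (le_iSup_of_le hQ ?_)
    refine le_iInf fun a => le_iInf fun _ => le_iInf fun hvol => ?_
    by_contra hcon
    have hlt : a < c Q := by exact_mod_cast not_le.1 hcon
    obtain ⟨-, hEQ, hEv⟩ := hE Q Q.2
    have hsub : E Q ⊆ {x | (a : ℝ) < |(Q : AxisCube n).toSet.indicator f x|} := by
      intro y hy
      show (a : ℝ) < |(Q : AxisCube n).toSet.indicator f y|
      rw [indicator_of_mem (hEQ hy), hf]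
      simp only [hmem Q y hy, ENNReal.coe_toReal, NNReal.abs_eq]
      exact_mod_cast hlt
    have h1 := (hEv.trans (measure_mono hsub)).trans hvol
    rw [ENNReal.mul_le_mul_iff_left (AxisCube.volume_ne_zero _) (AxisCube.volume_ne_top _),
      ENNReal.ofReal_le_ofReal_iff ht0.le] at h1
    linarith
  · push Not at hx
    have : stepSum F c AxisCube.toSet x = 0 :=
      tsum_indicator_of_forall_notMem (c := fun Q : F => (c Q : ℝ≥0∞)) hx
    rw [this]
    exact zero_le

end Equivalence

end VarExp

theorem theorem1p5 (n : ℕ) (hn : 0 < n) (p : (Fin n → ℝ) → ENNReal)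
    (hp : AEMeasurable p MeasureTheory.volume)
    (hp_minus : 1 ≤ essInf p MeasureTheory.volume)
    (hp_plus : essSup p MeasureTheory.volume < ⊤) :
    VarExp.AInfty p ↔ ∃ t ∈ Set.Ioo (0 : ℝ) 1, VarExp.MedianMaximalBounded t p := by
  obtain ⟨q, P, hq, hpq⟩ := VarExp.exists_bddExponent hp hp_minus hp_plus
  constructor
  · intro h
    exact ⟨1 / 2, ⟨by norm_num, by norm_num⟩, h.medianMaximalBounded hn hq hpq⟩
  · rintro ⟨t, ht, h⟩
    exact h.aInfty ht
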